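/- Let $n\ge 1$ and let $w_1,\dots,w_n$ be positive integers; put $w_0=1$, $\mu=1+w_1+\cdots+w_n$. Let $U=(\mathbb C^*)^n$ with coordinates $u_1,\dots,u_n$, $u_0=1/(u_1^{w_1}\cdots u_n^{w_n})$ and $F=u_1+\cdots+u_n+x\,u_0$, where $x$ is a parameter in $\mathbb C^*$. Let $$G=\frac{\Omega^n(U)[\tau,\tau^{-1},x,x^{-1}]}{(d_u-\tau\, d_uF\wedge)\,\Omega^{n-1}(U)[\tau,\tau^{-1},x,x^{-1}]}$$ be the Fourier-Laplace transform of the Gauss-Manin system of $F$, with the operators $\nabla_{\partial_\tau}(\omega\tau^i)=i\omega\tau^{i-1}-F\omega\tau^i$ and $\nabla_{\partial_x}(\omega\tau^i)=\frac{\partial\omega}{\partial x}\tau^i-\frac{\partial F}{\partial x}\omega\tau^{i+1}$ (for $\omega\in\Omega^n(U)[x,x^{-1}]$). Put $\theta=\tau^{-1}$, so that $\nabla_{\partial_\theta}=-\tau^2\nabla_{\partial_\tau}$. Number the elements of the disjoint union, over $i=0,\dots,n$, of the sets $\{\ell\mu/w_i : 0\le \ell<w_i\}$ increasingly as $s_0\le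 s_1\le\cdots\le s_{\mu-1}$, equal numbers being ordered by the index $i$ of the set they come from, and let $i(k)$ be the index of the set from which $s_k$ comes. Put $\alpha_k=k-s_k$, $A_\infty=\mathrm{diag}(\alpha_0,\dots,\alpha_{\mu-1})$ and $R^\varphi=\mathrm{diag}(0,\dots,0,\frac{s_{n+1}}{\mu},\dots,\frac{s_{\mu-1}}{\mu})$ (with $n+1$ zeros). Let $A_0^\varphi(x)$ be the $\mu\times\mu$ matrix with all entries just below the diagonal equal to $\mu$, upper right entry $\mu x/(w_1^{w_1}\cdots w_n^{w_n})$, and all other entries $0$; let $\overline A{}_0^\varphi=A_0^\varphi(0)$. Define sections of $G$ by $\omega_0^\varphi=[\frac{du_1}{u_1}\wedge\cdots\wedge\frac{du_n}{u_n}]$ and $\omega_k^\varphi=\big[\prod_{j<k}\frac{v_{i(j)}}{w_{i(j)}}\;\frac{du_1}{u_1}\wedge\cdots\wedge\frac{du_n}{u_n}\big]$ for $0\le k\le\mu-1$, where $v_0=xu_0$ and $v_i=u_i$ for $i\ge1$. Let $\mathcal L^\varphi\subset G$ be the $\mathbb C[x,\theta,\theta^{-1}]$-submodule generated by $\omega^\varphi_0,\dots,\omega^\varphi_{\mu-1}$,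 and $\overline{\mathcal L}{}^\varphi=\mathcal L^\varphi/x\mathcal L^\varphi$. Then $\nabla$ is a flat connection on $G$, and: 1) $\mathcal L^\varphi$ is free over $\mathbb C[x,\theta,\theta^{-1}]$ with basis $\omega^\varphi$, and it is stable under $x\nabla_{\partial_x}$ and $\nabla_{\partial_\theta}$; that is, $\nabla$ restricts to a connection on $\mathcal L^\varphi$ with a logarithmic pole along $x=0$. In the basis $\omega^\varphi$ the matrix of $x\nabla_{\partial_x}$ is $-\frac{A_0^\varphi(x)}{\mu\theta}+R^\varphi$, and the matrix of $\nabla_{\partial_\theta}$ is $\frac{A_0^\varphi(x)}{\theta^2}+\frac{A_\infty}{\theta}$. 2) The classes $\overline\omega{}^\varphi$ of $\omega^\varphi$ form a basis of $\overline{\mathcal L}{}^\varphi$ over $\mathbb C[\theta,\theta^{-1}]$. The residue, that is the $\mathbb C[\theta,\theta^{-1}]$-linear map induced by $x\nabla_{\partial_x}$ on $\overline{\mathcal L}{}^\varphi$, has matrix $-\frac{\overline A{}_0^\varphi}{\mu\theta}+R^\varphi$ in this basis, and its eigenvalues (on the fibre at each $\theta\ne0$) are contained in $[0,1)$. 3)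 $\nabla_{\partial_\theta}$ induces a connection on $\overline{\mathcal L}{}^\varphi$, with matrix $\frac{\overline A{}_0^\varphi}{\theta^2}+\frac{A_\infty}{\theta}$ in the basis $\overline\omega{}^\varphi$. 4) $\mathcal L^\varphi$ is Deligne's canonical extension of $G$ across $x=0$ with residue eigenvalues in $[0,1)$: it is the unique finitely generated projective $\mathbb C[x,\theta,\theta^{-1}]$-submodule $L$ of $G$ that generates $G$ over $\mathbb C[x,x^{-1},\theta,\theta^{-1}]$, is stable under $x\nabla_{\partial_x}$ and $\nabla_{\partial_\theta}$, and on which the residue of $\nabla$ along $x=0$ has all its eigenvalues in $[0,1)$, on the fibre at each $\theta\neq0$. -/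

import Mathlib

noncomputable section

namespace GaussManin

open LaurentPolynomial

/-! ### Rings, with `θ = τ⁻¹` -/

/-- `ℂ[τ, τ⁻¹] = ℂ[θ, θ⁻¹]`; the variable `T 1` is `τ`, so that `T (-1)` is `θ`. -/
abbrev RTau : Type := LaurentPolynomial ℂ

/-- `ℂ[x, θ, θ⁻¹]`, functions on `{θ ≠ 0} × ℂ`; the variable `Polynomial.X` is `x`. -/
abbrev RLog : Type := Polynomial RTau

/-- `ℂ[x, x⁻¹, τ, τ⁻¹]`; the outer variable `T 1` is `x`. -/
abbrev RTot : Type := LaurentPolynomial RTau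

/-- `ℂ[u₁^±, …, uₙ^±][τ, τ⁻¹, x, x⁻¹]`, functions on the torus `U` with the parameters adjoined. -/
abbrev Coord (n : ℕ) : Type := AddMonoidAlgebra RTot (Fin n → ℤ)

instance : CommRing RTau := inferInstance
instance : CommRing RTot := inferInstance
instance : CommRing RLog := inferInstance
instance (n : ℕ) : CommRing (Coord n) := inferInstance
instance (n : ℕ) : AddCommGroup (Coord n) := inferInstance

instance : IsScalarTower RTau RLog RTot :=
  IsScalarTower.of_algebraMap_eq fun a => by
    rw [LaurentPolynomial.algebraMap_eq_toLaurent]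
    simp

/-! ### Derivations of Laurent polynomial rings -/

section Derivations

variable {k S M : Type} [CommRing k] [CommRing S] [Algebra k S] [AddCommMonoid M]

/-- The `k`-linear map `∑ s_m X^m ↦ ∑ (δ s_m + φ m * s_m) X^m` of `S[M]`. -/
def monomialMap (δ : Derivation k S S) (φ : M →+ S) :
    AddMonoidAlgebra S M →ₗ[k] AddMonoidAlgebra S M :=
  (Finsupp.lsum k fun m : M =>
      AddMonoidAlgebra.lsingle m ∘ₗ ((δ : S →ₗ[k] S) + LinearMap.mulLeft k (φ m))) ∘ₗ
    (AddMonoidAlgebra.coeffLinearEquiv k).toLinearMap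

theorem monomialMap_single (δ : Derivation k S S) (φ : M →+ S) (m : M) (s : S) :
    monomialMap δ φ (AddMonoidAlgebra.single m s) =
      AddMonoidAlgebra.single m (δ s + φ m * s) := by
  simp [monomialMap]

/-- The map `monomialMap δ φ` as a derivation. -/
def monomialDer (δ : Derivation k S S) (φ : M →+ S) :
    Derivation k (AddMonoidAlgebra S M) (AddMonoidAlgebra S M) :=
  Derivation.mk' (monomialMap δ φ) fun a b => by
    induction a using AddMonoidAlgebra.induction_linear with
    | zero => simp
    | add f g hf hg => simp only [add_mul, map_add, hf, hg, smul_eq_mul, mul_add]; ring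
    | single m r =>
      induction b using AddMonoidAlgebra.induction_linear with
      | zero => simp
      | add f g hf hg => simp only [add_mul, map_add, hf, hg, smul_eq_mul, mul_add]; ring
      | single m' r' =>
        simp only [AddMonoidAlgebra.single_mul_single, monomialMap_single, smul_eq_mul,
          Derivation.leibniz, map_add]
        rw [add_comm m' m, ← AddMonoidAlgebra.single_add]
        congr 1
        ring

theorem monomialDer_single (δ : Derivation k S S) (φ : M →+ S) (m : M) (s : S) :
    monomialDer δ φ (AddMonoidAlgebra.single m s) =
      AddMonoidAlgebra.single m (δ s + φ m * s) :=
  monomialMap_single δ φ m s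

/-- The derivation of `S[M]` that applies `δ` to the coefficients and kills the monomials. -/
def coeffDer (M : Type) [AddCommMonoid M] (δ : Derivation k S S) :
    Derivation k (AddMonoidAlgebra S M) (AddMonoidAlgebra S M) :=
  monomialDer δ 0

/-- The derivation of `S[M]` that kills `S` and multiplies the monomial of exponent `m`
by `φ m`. -/
def eulerDer (φ : M →+ S) : Derivation S (AddMonoidAlgebra S M) (AddMonoidAlgebra S M) :=
  monomialDer (0 : Derivation S S S) φ

/-- The derivative `d/dT` of Laurent polynomials in `T`, that is `T⁻¹ • (T d/dT)`. -/
def laurentDer (S : Type) [CommRing S] :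
    Derivation S (LaurentPolynomial S) (LaurentPolynomial S) :=
  (T (-1) : LaurentPolynomial S) • eulerDer (Int.castAddHom S)

theorem coeffDer_smul (δ : Derivation k S S) (s : S) (a : AddMonoidAlgebra S M) :
    coeffDer M δ (s • a) = δ s • a + s • coeffDer M δ a := by
  induction a using AddMonoidAlgebra.induction_linear with
  | zero => simp
  | add f g hf hg => simp only [smul_add, map_add, hf, hg]; abel
  | single m r =>
    simp only [coeffDer, AddMonoidAlgebra.smul_single, monomialDer_single, smul_eq_mul,
      Derivation.leibniz, ← AddMonoidAlgebra.single_add]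
    congr 1
    simp
    ring

theorem laurentDer_single (m : ℤ) (s : S) :
    laurentDer S (AddMonoidAlgebra.single m s) =
      AddMonoidAlgebra.single (m - 1) ((m : S) * s) := by
  simp only [laurentDer, eulerDer, Derivation.smul_apply, monomialDer_single, smul_eq_mul, T,
    AddMonoidAlgebra.single_mul_single, Derivation.coe_zero, Pi.zero_apply, zero_add, one_mul,
    Int.coe_castAddHom]
  congr 1
  ring

end Derivations

/-- `∂/∂τ` on `ℂ[τ, τ⁻¹]`. -/
def dTau₀ : Derivation ℂ RTau RTau := laurentDer ℂ

/-- `∂/∂τ` on `ℂ[x, x⁻¹, τ, τ⁻¹]`. -/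
def dTau₁ : Derivation ℂ RTot RTot := coeffDer ℤ dTau₀

/-- `∂/∂x` on `ℂ[x, x⁻¹, τ, τ⁻¹]`. -/
def dX₁ : Derivation RTau RTot RTot := laurentDer RTau

/-- `∂/∂θ = -τ² ∂/∂τ` on `ℂ[τ, τ⁻¹]`, where `θ = τ⁻¹`. -/
def dTheta₀ : Derivation ℂ RTau RTau := (-T 2 : RTau) • dTau₀

/-- `∂/∂θ = -τ² ∂/∂τ` on `ℂ[x, x⁻¹, τ, τ⁻¹]`, where `θ = τ⁻¹`. -/
def dTheta₁ : Derivation ℂ RTot RTot := (algebraMap RTau RTot (-T 2)) • dTau₁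

/-- `∂/∂τ` on functions on the torus with parameters. -/
def dTau (n : ℕ) : Derivation ℂ (Coord n) (Coord n) := coeffDer (Fin n → ℤ) dTau₁

/-- `∂/∂x` on functions on the torus with parameters. -/
def dX (n : ℕ) : Derivation RTau (Coord n) (Coord n) := coeffDer (Fin n → ℤ) dX₁

/-- The logarithmic derivative `u_i ∂/∂u_i`. -/
def dLogU {n : ℕ} (i : Fin n) : Derivation RTot (Coord n) (Coord n) :=
  eulerDer ((Int.castAddHom RTot).comp (Pi.evalAddMonoidHom (fun _ : Fin n => ℤ) i))

/-! ### Relative differential forms on the torus -/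

/-- Relative `p`-forms on the torus `U`, with the parameters `τ^±, x^±` adjoined to the
coefficients: `η` stands for `∑_S η S • du_S/u_S`, where, for `S = {i₁ < ⋯ < i_p}`,
`du_S/u_S` is `du_{i₁}/u_{i₁} ∧ ⋯ ∧ du_{i_p}/u_{i_p}`. -/
abbrev LogForm (n p : ℕ) : Type := {S : Finset (Fin n) // S.card = p} → Coord n

/-- The coefficient of `du_S/u_S` in a `p`-form; it is `0` if `S` does not have `p` elements. -/
def LogForm.coeffAt {n : ℕ} (p : ℕ) (S : Finset (Fin n)) : LogForm n p →ₗ[RTot] Coord n :=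
  if h : S.card = p then LinearMap.proj ⟨S, h⟩ else 0

/-- For operators `c i` on functions, the map `g • du_S/u_S ↦ ∑_i c i g • du_i/u_i ∧ du_S/u_S`
from `p`-forms to `q`-forms, where `q = p + 1` (it is `0` for the other `q`). -/
def wedgeWith {n : ℕ} (c : Fin n → Coord n →ₗ[RTot] Coord n) (p q : ℕ) :
    LogForm n p →ₗ[RTot] LogForm n q :=
  LinearMap.pi fun S => ∑ i ∈ S.1,
    ((-1 : ℤ) ^ (S.1.filter (· < i)).card) • (c i ∘ₗ LogForm.coeffAt p (S.1.erase i))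

/-- The exterior differential `d_u` with respect to the torus variables. -/
def extD (n p q : ℕ) : LogForm n p →ₗ[RTot] LogForm n q :=
  wedgeWith (fun i => (dLogU i : Coord n →ₗ[RTot] Coord n)) p q

/-- The map `η ↦ d_u F ∧ η`. -/
def dWedge {n : ℕ} (F : Coord n) (p q : ℕ) : LogForm n p →ₗ[RTot] LogForm n q :=
  wedgeWith (fun i => LinearMap.mulLeft RTot (dLogU i F)) p q

/-! ### The deformation and its Gauss-Manin system -/

variable {n : ℕ}

/-- The monomial `u₀ = 1 / (u₁^{w₁} ⋯ uₙ^{wₙ})`. -/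
def u0 (w : Fin n → ℕ) : Coord n := AddMonoidAlgebra.single (fun i => -(w i : ℤ)) 1

/-- The coordinate `u_i`. -/
def u (i : Fin n) : Coord n := AddMonoidAlgebra.single (Pi.single i 1) 1

/-- `F = u₁ + ⋯ + uₙ + x / (u₁^{w₁} ⋯ uₙ^{wₙ})`. -/
def F (w : Fin n → ℕ) : Coord n := ∑ i, u i + (T 1 : RTot) • u0 w

/-- The subspace `(d_u - τ d_u F ∧) Ω^{n-1}` of the space of `n`-forms. -/
def relations (w : Fin n → ℕ) : Submodule RTot (LogForm n n) :=
  LinearMap.range (extD n (n - 1) n - (algebraMap RTau RTot (T 1)) • dWedge (F w) (n - 1) n)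

/-- The (Fourier-Laplace transform of the) Gauss-Manin system of `F`. -/
def GM (w : Fin n → ℕ) : Type := LogForm n n ⧸ relations w

instance (w : Fin n → ℕ) : AddCommGroup (GM w) :=
  inferInstanceAs (AddCommGroup (LogForm n n ⧸ relations w))
instance (w : Fin n → ℕ) : Module RTot (GM w) :=
  inferInstanceAs (Module RTot (LogForm n n ⧸ relations w))
instance (w : Fin n → ℕ) : Module RLog (GM w) :=
  inferInstanceAs (Module RLog (LogForm n n ⧸ relations w))
instance (w : Fin n → ℕ) : Module RTau (GM w) :=
  inferInstanceAs (Module RTau (LogForm n n ⧸ relations w))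
instance (w : Fin n → ℕ) : Module ℂ (GM w) :=
  inferInstanceAs (Module ℂ (LogForm n n ⧸ relations w))
instance (w : Fin n → ℕ) : IsScalarTower RLog RTot (GM w) :=
  inferInstanceAs (IsScalarTower RLog RTot (LogForm n n ⧸ relations w))
instance (w : Fin n → ℕ) : IsScalarTower RTau RTot (GM w) :=
  inferInstanceAs (IsScalarTower RTau RTot (LogForm n n ⧸ relations w))
instance (w : Fin n → ℕ) : IsScalarTower RTau RLog (GM w) :=
  inferInstanceAs (IsScalarTower RTau RLog (LogForm n n ⧸ relations w))
instance (w : Fin n → ℕ) : IsScalarTower ℂ RTau (GM w) :=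
  inferInstanceAs (IsScalarTower ℂ RTau (LogForm n n ⧸ relations w))
instance (w : Fin n → ℕ) : IsScalarTower ℂ RLog (GM w) :=
  ⟨fun c p m => by
    rw [← algebraMap_smul RTau c p, smul_assoc, algebraMap_smul]⟩
instance (w : Fin n → ℕ) : IsScalarTower ℂ RTot (GM w) :=
  inferInstanceAs (IsScalarTower ℂ RTot (LogForm n n ⧸ relations w))

/-- The class of an `n`-form in the Gauss-Manin system. -/
def mkGM (w : Fin n → ℕ) : LogForm n n →ₗ[RTot] GM w := (relations w).mkQ

theorem mkGM_surjective (w : Fin n → ℕ) : Function.Surjective (mkGM w) :=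
  (relations w).mkQ_surjective

/-- `η ↦ ∂η/∂x - τ (∂F/∂x) η` on forms. -/
def formNablaX (w : Fin n → ℕ) (p : ℕ) : LogForm n p →ₗ[RTau] LogForm n p :=
  LinearMap.compLeft ((dX n : Coord n →ₗ[RTau] Coord n) -
    (T 1 : RTau) • LinearMap.mulLeft RTau (dX n (F w))) _

/-- `η ↦ ∂η/∂τ - F η` on forms; on `ω τ^i`, with `ω` free of `τ`, this is
`i ω τ^{i-1} - F ω τ^i`. -/
def formNablaTau (w : Fin n → ℕ) (p : ℕ) : LogForm n p →ₗ[ℂ] LogForm n p :=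
  LinearMap.compLeft ((dTau n : Coord n →ₗ[ℂ] Coord n) - LinearMap.mulLeft ℂ (F w)) _

theorem coeffAt_map (p : ℕ) (f : Coord n →+ Coord n) (S : Finset (Fin n)) (η : LogForm n p) :
    LogForm.coeffAt p S (fun T => f (η T)) = f (LogForm.coeffAt p S η) := by
  unfold LogForm.coeffAt
  split <;> simp

theorem wedgeWith_apply (c : Fin n → Coord n →ₗ[RTot] Coord n) (p q : ℕ) (η : LogForm n p)
    (S : {S : Finset (Fin n) // S.card = q}) :
    wedgeWith c p q η S = ∑ i ∈ S.1, ((-1 : ℤ) ^ (S.1.filter (· < i)).card) •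
      c i (LogForm.coeffAt p (S.1.erase i) η) := by
  simp [wedgeWith]

theorem map_mem_relations (w : Fin n → ℕ) (f : Coord n →+ Coord n)
    (hf : ∀ i g, f (dLogU i g - (algebraMap RTau RTot (T 1)) • (dLogU i (F w) * g)) =
      dLogU i (f g) - (algebraMap RTau RTot (T 1)) • (dLogU i (F w) * f g))
    (η : LogForm n n) (hη : η ∈ relations w) : (fun S => f (η S)) ∈ relations w := by
  obtain ⟨ξ, rfl⟩ := hη
  refine ⟨fun S => f (ξ S), ?_⟩
  funext S
  simp only [extD, dWedge, LinearMap.sub_apply, LinearMap.smul_apply, Pi.sub_apply, Pi.smul_apply,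
    wedgeWith_apply, Finset.smul_sum, ← Finset.sum_sub_distrib, map_sum, coeffAt_map]
  refine Finset.sum_congr rfl fun i _ => ?_
  have := hf i (LogForm.coeffAt (n - 1) (S.1.erase i) ξ)
  simp only [LinearMap.mulLeft_apply, Derivation.coeFn_coe]
  rw [smul_comm, ← smul_sub, smul_comm, ← smul_sub, map_zsmul, this]

theorem dLogU_single (i : Fin n) (m : Fin n → ℤ) (r : RTot) :
    dLogU i (AddMonoidAlgebra.single m r : Coord n) =
      AddMonoidAlgebra.single m ((m i : RTot) * r) := by
  simp [dLogU, eulerDer, monomialDer_single]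

theorem dX_single (m : Fin n → ℤ) (r : RTot) :
    dX n (AddMonoidAlgebra.single m r) = AddMonoidAlgebra.single m (dX₁ r) := by
  simp [dX, coeffDer, monomialDer_single]

theorem dTau_single (m : Fin n → ℤ) (r : RTot) :
    dTau n (AddMonoidAlgebra.single m r) = AddMonoidAlgebra.single m (dTau₁ r) := by
  simp [dTau, coeffDer, monomialDer_single]

theorem dX_dLogU (i : Fin n) (g : Coord n) : dX n (dLogU i g) = dLogU i (dX n g) := by
  induction g using AddMonoidAlgebra.induction_linear with
  | zero => simp
  | add f g hf hg => simp only [map_add, hf, hg]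
  | single m r => simp [dLogU_single, dX_single]

theorem dTau_dLogU (i : Fin n) (g : Coord n) : dTau n (dLogU i g) = dLogU i (dTau n g) := by
  induction g using AddMonoidAlgebra.induction_linear with
  | zero => simp
  | add f g hf hg => simp only [map_add, hf, hg]
  | single m r => simp [dLogU_single, dTau_single]

theorem dTau_F (w : Fin n → ℕ) : dTau n (F w) = 0 := by
  have h : ∀ m : ℤ, dTau₁ (AddMonoidAlgebra.single m 1) = 0 := fun m => by
    rw [dTau₁, coeffDer, monomialDer_single]
    simp
  have h1 : dTau₁ 1 = 0 := Derivation.map_one_eq_zero _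
  rw [F, u0, AddMonoidAlgebra.smul_single, map_add, map_sum, dTau_single, smul_eq_mul, mul_one, T,
    h, AddMonoidAlgebra.single_zero, add_zero]
  exact Finset.sum_eq_zero fun i _ => by rw [u, dTau_single, h1, AddMonoidAlgebra.single_zero]

theorem dTau₁_algebraMap (a : RTau) :
    dTau₁ (algebraMap RTau RTot a) = algebraMap RTau RTot (dTau₀ a) := by
  rw [LaurentPolynomial.algebraMap_apply, LaurentPolynomial.algebraMap_apply,
    ← LaurentPolynomial.single_eq_C, ← LaurentPolynomial.single_eq_C, dTau₁, coeffDer,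
    monomialDer_single]
  simp only [AddMonoidHom.zero_apply, zero_mul, add_zero]
  rfl

theorem dTau_smul (r : RTot) (g : Coord n) : dTau n (r • g) = dTau₁ r • g + r • dTau n g :=
  coeffDer_smul _ _ _ 

theorem dX_smul (r : RTot) (g : Coord n) : dX n (r • g) = dX₁ r • g + r • dX n g :=
  coeffDer_smul _ _ _

theorem dTau_tau_smul (g : Coord n) :
    dTau n ((T 1 : RTau) • g) = g + (T 1 : RTau) • dTau n g := by
  rw [← algebraMap_smul RTot (T 1 : RTau) g, dTau_smul, dTau₁_algebraMap, dTau₀, T,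
    laurentDer_single, algebraMap_smul, algebraMap_smul]
  simp

theorem formNablaX_relations (w : Fin n → ℕ) :
    ∀ η ∈ relations w, formNablaX w n η ∈ relations w := by
  refine map_mem_relations w ((dX n : Coord n →ₗ[RTau] Coord n) -
    (T 1 : RTau) • LinearMap.mulLeft RTau (dX n (F w))).toAddMonoidHom fun i g => ?_
  have h1 : ∀ (a : Coord n), (algebraMap RTau RTot (T 1)) • a = (T 1 : RTau) • a := fun a =>
    algebraMap_smul _ _ _
  have h2 : ∀ a : Coord n, dLogU i ((T 1 : RTau) • a) = (T 1 : RTau) • dLogU i a := fun a => by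
    rw [← h1, Derivation.map_smul, h1]
  simp only [h1, LinearMap.toAddMonoidHom_coe, LinearMap.sub_apply, Derivation.coeFn_coe,
    LinearMap.smul_apply, LinearMap.mulLeft_apply, map_sub, h2, Derivation.map_smul,
    Derivation.leibniz, dX_dLogU, smul_eq_mul, mul_sub, smul_add, smul_sub,
    mul_smul_comm]
  rw [mul_left_comm (dX n (F w))]
  abel

theorem formNablaTau_relations (w : Fin n → ℕ) :
    ∀ η ∈ relations w, formNablaTau w n η ∈ relations w := by
  refine map_mem_relations w ((dTau n : Coord n →ₗ[ℂ] Coord n) -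
    LinearMap.mulLeft ℂ (F w)).toAddMonoidHom fun i g => ?_
  have h1 : ∀ (a : Coord n), (algebraMap RTau RTot (T 1)) • a = (T 1 : RTau) • a := fun a =>
    algebraMap_smul _ _ _
  simp only [h1, LinearMap.toAddMonoidHom_coe, LinearMap.sub_apply, Derivation.coeFn_coe,
    LinearMap.mulLeft_apply, map_sub, dTau_tau_smul,
    Derivation.leibniz, dTau_dLogU, dTau_F, smul_eq_mul, mul_sub, smul_sub,
    mul_smul_comm, mul_zero, map_zero, add_zero]
  rw [mul_left_comm (F w), mul_comm g]
  abel

/-- The map induced on a quotient of `R`-modules by a map that is only linear over `k`. -/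
def descend {k R M : Type} [CommRing k] [CommRing R] [Algebra k R] [AddCommGroup M] [Module R M]
    [Module k M] [IsScalarTower k R M] (N : Submodule R M) (f : M →ₗ[k] M)
    (hf : ∀ m ∈ N, f m ∈ N) : (M ⧸ N) →ₗ[k] (M ⧸ N) :=
  (Submodule.Quotient.restrictScalarsEquiv k N).toLinearMap ∘ₗ
    (Submodule.mapQ (N.restrictScalars k) (N.restrictScalars k) f hf) ∘ₗ
      (Submodule.Quotient.restrictScalarsEquiv k N).symm.toLinearMap

theorem descend_mk {k R M : Type} [CommRing k] [CommRing R] [Algebra k R] [AddCommGroup M]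
    [Module R M] [Module k M] [IsScalarTower k R M] (N : Submodule R M) (f : M →ₗ[k] M)
    (hf : ∀ m ∈ N, f m ∈ N) (m : M) :
    descend N f hf (Submodule.Quotient.mk m) = Submodule.Quotient.mk (f m) := rfl

/-- `∇_{∂_x}` on the Gauss-Manin system. -/
def nablaX (w : Fin n → ℕ) : GM w →ₗ[RTau] GM w :=
  descend (relations w) (formNablaX w n) (formNablaX_relations w)

/-- `∇_{∂_τ}` on the Gauss-Manin system. -/
def nablaTau (w : Fin n → ℕ) : GM w →ₗ[ℂ] GM w :=
  descend (relations w) (formNablaTau w n) (formNablaTau_relations w)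

/-- `x ∇_{∂_x}` on the Gauss-Manin system. -/
def xNablaX (w : Fin n → ℕ) : GM w →ₗ[RTau] GM w := (T 1 : RTot) • nablaX w

/-- `∇_{∂_θ} = -τ² ∇_{∂_τ}` on the Gauss-Manin system. -/
def nablaTheta (w : Fin n → ℕ) : GM w →ₗ[ℂ] GM w := (-T 2 : RTau) • nablaTau w

theorem nablaX_mkGM (w : Fin n → ℕ) (η : LogForm n n) :
    nablaX w (mkGM w η) = mkGM w (formNablaX w n η) := rfl

theorem nablaTau_mkGM (w : Fin n → ℕ) (η : LogForm n n) :
    nablaTau w (mkGM w η) = mkGM w (formNablaTau w n η) := rfl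

theorem nablaX_smul (w : Fin n → ℕ) (r : RTot) (m : GM w) :
    nablaX w (r • m) = dX₁ r • m + r • nablaX w m := by
  obtain ⟨η, rfl⟩ := mkGM_surjective w m
  rw [← map_smul, nablaX_mkGM, nablaX_mkGM, ← map_smul, ← map_smul, ← map_add]
  refine congrArg (mkGM w) ?_
  funext S
  simp only [formNablaX, LinearMap.compLeft_apply, Function.comp_apply, LinearMap.sub_apply,
    Pi.add_apply, Pi.smul_apply, Derivation.coeFn_coe, dX_smul, LinearMap.smul_apply,
    LinearMap.mulLeft_apply, mul_smul_comm, smul_sub]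
  rw [smul_comm (T 1 : RTau) r]
  abel

theorem nablaTau_smul (w : Fin n → ℕ) (r : RTot) (m : GM w) :
    nablaTau w (r • m) = dTau₁ r • m + r • nablaTau w m := by
  obtain ⟨η, rfl⟩ := mkGM_surjective w m
  rw [← map_smul, nablaTau_mkGM, nablaTau_mkGM, ← map_smul, ← map_smul, ← map_add]
  refine congrArg (mkGM w) ?_
  funext S
  simp only [formNablaTau, LinearMap.compLeft_apply, Function.comp_apply, LinearMap.sub_apply,
    Pi.add_apply, Pi.smul_apply, Derivation.coeFn_coe, dTau_smul,
    LinearMap.mulLeft_apply, mul_smul_comm, smul_sub]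
  abel

theorem X_smul (w : Fin n → ℕ) (m : GM w) :
    (Polynomial.X : RLog) • m = (T 1 : RTot) • m := by
  rw [← algebraMap_smul RTot (Polynomial.X : RLog) m]
  congr 1
  simp

theorem xNablaX_X_smul (w : Fin n → ℕ) (m : GM w) :
    xNablaX w ((Polynomial.X : RLog) • m) = (Polynomial.X : RLog) • (m + xNablaX w m) := by
  have h : dX₁ (T 1) = 1 := by
    rw [dX₁, T, laurentDer_single]
    simp
  simp only [X_smul, xNablaX, LinearMap.smul_apply, nablaX_smul, h, one_smul]

theorem nablaTheta_X_smul (w : Fin n → ℕ) (m : GM w) :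
    nablaTheta w ((Polynomial.X : RLog) • m) = (Polynomial.X : RLog) • nablaTheta w m := by
  have h : dTau₁ (T 1) = 0 := by
    rw [dTau₁, coeffDer, T, monomialDer_single]
    simp
  simp only [X_smul, nablaTheta, LinearMap.smul_apply, nablaTau_smul, h, zero_smul, zero_add]
  exact smul_comm _ _ _

/-! ### Lattices with a logarithmic pole along `x = 0`, and their residues -/

section Lattices

variable {w : Fin n → ℕ}

/-- The restriction of an operator to a lattice that is stable under it. -/
def restrictOp {k : Type} [CommRing k] [Algebra k RLog] [Module k (GM w)]
    [IsScalarTower k RLog (GM w)] (L : Submodule RLog (GM w)) (f : GM w →ₗ[k] GM w)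
    (hf : ∀ m ∈ L, f m ∈ L) : L →ₗ[k] L where
  toFun m := ⟨f m, hf m m.2⟩
  map_add' _ _ := Subtype.ext (map_add f _ _)
  map_smul' c _ := Subtype.ext (map_smul f c _)

/-- The submodule `x L` of `L`. -/
def xMul (L : Submodule RLog (GM w)) : Submodule RLog L :=
  LinearMap.range (LinearMap.lsmul RLog L Polynomial.X)

/-- The restriction `L / x L` of `L` to `x = 0`. -/
abbrev Lbar (L : Submodule RLog (GM w)) : Type := L ⧸ xMul L

/-- The residue along `x = 0`: the endomorphism of `L / x L` induced by `x ∇_{∂_x}`. -/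
def residue (L : Submodule RLog (GM w)) (h : ∀ m ∈ L, xNablaX w m ∈ L) :
    Module.End RTau (Lbar L) :=
  descend (xMul L) (restrictOp L (xNablaX w) h) (by
    rintro _ ⟨m, rfl⟩
    exact ⟨m + restrictOp L (xNablaX w) h m, Subtype.ext (xNablaX_X_smul w m).symm⟩)

/-- The map on `L / x L` induced by `∇_{∂_θ}`. -/
def thetaBar (L : Submodule RLog (GM w)) (h : ∀ m ∈ L, nablaTheta w m ∈ L) :
    Lbar L →ₗ[ℂ] Lbar L :=
  descend (xMul L) (restrictOp L (nablaTheta w) h) (by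
    rintro _ ⟨m, rfl⟩
    exact ⟨restrictOp L (nablaTheta w) h m, Subtype.ext (nablaTheta_X_smul w m).symm⟩)

end Lattices

/-- The submodule `(θ - θ₀) M` of a `ℂ[θ, θ⁻¹]`-module `M`. -/
def thetaSub (M : Type) [AddCommGroup M] [Module RTau M] (θ₀ : ℂ) : Submodule RTau M :=
  LinearMap.range (LinearMap.lsmul RTau M (T (-1) - C θ₀))

/-- The endomorphism induced by `ρ` on the fibre `M / (θ - θ₀) M`. -/
def fibreEnd {M : Type} [AddCommGroup M] [Module RTau M] (ρ : Module.End RTau M) (θ₀ : ℂ) :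
    Module.End RTau (M ⧸ thetaSub M θ₀) :=
  (thetaSub M θ₀).mapQ (thetaSub M θ₀) ρ (by
    rintro _ ⟨m, rfl⟩
    exact ⟨ρ m, by simp⟩)

/-- For every `θ₀ ≠ 0`, the eigenvalues of `ρ` on the fibre at `θ₀` belong to `I`. (On the fibre,
`ℂ[θ, θ⁻¹]` acts through its quotient `ℂ`, and every eigenvalue is given by a constant.) -/
def EigenvaluesIn {M : Type} [AddCommGroup M] [Module RTau M] (ρ : Module.End RTau M)
    (I : Set ℝ) : Prop :=
  ∀ θ₀ : ℂ, θ₀ ≠ 0 → ∀ z : ℂ, (fibreEnd ρ θ₀).HasEigenvalue (C z : RTau) → ∃ r ∈ I, z = (r : ℂ)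

/-- `L` is an extension of the bundle with connection `G` on `{θ ≠ 0, x ≠ 0}` to a vector bundle
on `{θ ≠ 0} × ℂ`, on which the connection has logarithmic poles along `x = 0`, with the
eigenvalues of the residue in `[0, 1)`. -/
def IsDeligneExtension {w : Fin n → ℕ} (L : Submodule RLog (GM w)) : Prop :=
  Module.Finite RLog L ∧ Module.Projective RLog L ∧
    Submodule.span RTot (L : Set (GM w)) = ⊤ ∧
    (∀ m ∈ L, nablaTheta w m ∈ L) ∧
    ∃ h : ∀ m ∈ L, xNablaX w m ∈ L, EigenvaluesIn (residue L h) (Set.Ico 0 1)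

/-! ### The numbers `s_k` and the sections `ω^φ_k` -/

/-- `w₀ = 1`, followed by `w₁, …, wₙ`. -/
def wt (w : Fin n → ℕ) : Fin (n + 1) → ℕ := Fin.cons 1 w

/-- `μ = 1 + w₁ + ⋯ + wₙ`. -/
def mu (w : Fin n → ℕ) : ℕ := 1 + ∑ i, w i

/-- The disjoint union, over `i = 0, …, n`, of the sets `{ℓ μ / w_i : 0 ≤ ℓ < w_i}`. An element
is recorded with the index `i` of the set it comes from; the order is that of the numbers, with
ties broken by the index. -/
def specSet (w : Fin n → ℕ) : Finset (ℚ ×ₗ Fin (n + 1)) :=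
  Finset.univ.image fun p : (i : Fin (n + 1)) × Fin (wt w i) =>
    toLex (((p.2 : ℕ) : ℚ) * mu w / wt w p.1, p.1)

theorem card_specSet (w : Fin n → ℕ) : (specSet w).card = mu w := by
  rw [specSet, Finset.card_image_of_injective]
  · rw [Finset.card_univ, Fintype.card_sigma]
    simp only [Fintype.card_fin]
    simp [mu, wt, Fin.sum_univ_succ]
  · rintro ⟨i, a⟩ ⟨j, b⟩ h
    have h' := Prod.ext_iff.1 (toLex.injective h)
    obtain rfl : i = j := h'.2
    have hw : (wt w i : ℚ) ≠ 0 := by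
      have := a.pos
      exact_mod_cast this.ne'
    have hm : (mu w : ℚ) ≠ 0 := by simp only [mu]; positivity
    have := h'.1
    simp only at this
    rw [div_left_inj' hw, mul_left_inj' hm] at this
    have hab : a = b := Fin.ext (by exact_mod_cast this)
    rw [hab]

/-- The increasing numbering, from `0` to `μ - 1`, of the disjoint union. -/
def specEnum (w : Fin n → ℕ) : Fin (mu w) ↪o ℚ ×ₗ Fin (n + 1) :=
  (specSet w).orderEmbOfFin (card_specSet w)

/-- The numbers `s₀ ≤ s₁ ≤ ⋯ ≤ s_{μ-1}`. -/
def s (w : Fin n → ℕ) (k : Fin (mu w)) : ℚ := (ofLex (specEnum w k)).1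

/-- The index `i(k)` of the set from which `s_k` comes. -/
def idx (w : Fin n → ℕ) (k : Fin (mu w)) : Fin (n + 1) := (ofLex (specEnum w k)).2

/-- `α_k = k - s_k`. -/
def alpha (w : Fin n → ℕ) (k : Fin (mu w)) : ℚ := ((k : ℕ) : ℚ) - s w k

/-- `x u₀, u₁, …, uₙ`, the terms of `F`. -/
def term (w : Fin n → ℕ) : Fin (n + 1) → Coord n := Fin.cons ((T 1 : RTot) • u0 w) u

/-- The class of `g • du₁/u₁ ∧ ⋯ ∧ duₙ/uₙ` in the Gauss-Manin system. -/
def classOf (w : Fin n → ℕ) (g : Coord n) : GM w := mkGM w fun _ => g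

/-- The sections `ω^φ_k`: `ω^φ_0 = du₁/u₁ ∧ ⋯ ∧ duₙ/uₙ`, and `ω^φ_{k+1}` is obtained from `ω^φ_k`
by multiplication by `(1 / w_{i(k)})` times the term of `F` of index `i(k)`. -/
def omegaPhi (w : Fin n → ℕ) (k : Fin (mu w)) : GM w :=
  classOf w (∏ j ∈ Finset.Iio k, ((wt w (idx w j) : ℂ)⁻¹ • term w (idx w j)))

/-- The lattice generated over `ℂ[x, θ, θ⁻¹]` by the sections `ω^φ_k`. -/
def LPhi (w : Fin n → ℕ) : Submodule RLog (GM w) :=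
  Submodule.span RLog (Set.range (omegaPhi w))

/-! ### The matrices -/

/-- The matrix `A₀^φ(x)`, with `μ` below the diagonal, and `μ x / (w₁^{w₁} ⋯ wₙ^{wₙ})` in the
upper right corner. -/
def A0Phi (w : Fin n → ℕ) : Matrix (Fin (mu w)) (Fin (mu w)) RLog := fun i j =>
  if (i : ℕ) = j + 1 then (mu w : RLog)
  else if (i : ℕ) = 0 ∧ (j : ℕ) + 1 = mu w then
    algebraMap ℂ RLog ((mu w : ℂ) / ∏ l, (w l : ℂ) ^ w l) * Polynomial.X
  else 0

/-- The value of `A₀^φ(x)` at `x = 0`. -/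
def A0PhiBar (w : Fin n → ℕ) : Matrix (Fin (mu w)) (Fin (mu w)) RTau :=
  (A0Phi w).map (Polynomial.eval 0)

/-- `diag (0, …, 0, s_{n+1} / μ, …, s_{μ-1} / μ)`, with `n + 1` zeros. -/
def RPhi (w : Fin n → ℕ) : Matrix (Fin (mu w)) (Fin (mu w)) ℂ :=
  Matrix.diagonal fun k => if (k : ℕ) ≤ n then 0 else ((s w k / mu w : ℚ) : ℂ)

/-- `A_∞ = diag (α₀, …, α_{μ-1})`. -/
def AInfty (w : Fin n → ℕ) : Matrix (Fin (mu w)) (Fin (mu w)) ℂ :=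
  Matrix.diagonal fun k => ((alpha w k : ℚ) : ℂ)

/-- `θ⁻¹ = τ` in `ℂ[θ, θ⁻¹]`. -/
def thetaInv : RTau := T 1

/-- The matrix of `x ∇_{∂_x}`: `-A₀^φ(x) / (μ θ) + diag (0, …, 0, s_{n+1} / μ, …, s_{μ-1} / μ)`. -/
def matX (w : Fin n → ℕ) : Matrix (Fin (mu w)) (Fin (mu w)) RLog :=
  -((Polynomial.C ((mu w : ℂ)⁻¹ • thetaInv)) • A0Phi w) + (RPhi w).map (algebraMap ℂ RLog)

/-- The matrix of `∇_{∂_θ}`: `A₀^φ(x) / θ² + A_∞ / θ`. -/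
def matTheta (w : Fin n → ℕ) : Matrix (Fin (mu w)) (Fin (mu w)) RLog :=
  (Polynomial.C (thetaInv ^ 2)) • A0Phi w +
    (Polynomial.C thetaInv) • (AInfty w).map (algebraMap ℂ RLog)

/-- The matrix `-A₀^φ(0) / (μ θ) + diag (0, …, 0, s_{n+1} / μ, …, s_{μ-1} / μ)`. -/
def matXBar (w : Fin n → ℕ) : Matrix (Fin (mu w)) (Fin (mu w)) RTau :=
  -(((mu w : ℂ)⁻¹ • thetaInv) • A0PhiBar w) + (RPhi w).map (algebraMap ℂ RTau)

/-- The matrix `A₀^φ(0) / θ² + A_∞ / θ`. -/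
def matThetaBar (w : Fin n → ℕ) : Matrix (Fin (mu w)) (Fin (mu w)) RTau :=
  (thetaInv ^ 2) • A0PhiBar w + thetaInv • (AInfty w).map (algebraMap ℂ RTau)

end GaussManin

end

noncomputable section

namespace GaussManin

open LaurentPolynomial

variable {n : ℕ}

/-! ### Combinatorics of the enumeration -/

/-! The terms $v_0=xu_0, v_1=u_1,\dots,v_n=u_n$ of $F$ satisfy $v_0\prod_i v_i^{w_i}=x$. Write
$E=x\nabla_{\partial_x}$, and $[v^c]$ for the class of a monomial in the $v_i$. The relations
defining $G$ amount to $\tau[v_iv^c]=(c_i-w_iE)[v^c]$ (`tau_smul_term_mul`); summing over $i$ gives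
$\nabla_{\partial_\theta}[v^c]=\tau(|c|-\mu E)[v^c]$ (`nablaTheta_vmon`).

The enumeration is built so that, if $c$ counts the indices used before step $k$, then
$c_{i(k)}/w_{i(k)}=s_k/\mu$ (`cnt_idx_mul`). Hence $\tau\omega_{k+1}=(s_k/\mu-E)\omega_k$. After
$\mu$ steps each index $i$ has been used $w_i$ times, the monomial is $x$, and the chain closes up
with $\omega_\mu=x\,\omega_0/\prod_i w_i^{w_i}$. These identities are the two matrices. Since every
$[v^c]$ is obtained from $\omega_0$ by operators in $E$, the sections generate $G$
(`span_omegaPhi`).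

For independence, the connection matrix is put on a free module of rank $\mu$, and $v^c$ is sent to
$\theta^{|c|}\prod_i\prod_{j<c_i}(j-w_iE)\,e_0$. This respects $v^{c+w}=x\,v^c$ (`modelVec_add_wt`),
kills the relations, and sends $\omega_k$ to $e_k$ (`linearIndependent_omegaPhi`).

At $x=0$ the matrix of $E$ is lower triangular with diagonal entries $s_k/\mu\in[0,1)$. For
uniqueness, let $L,L'$ be two such extensions, so that $x^NL\subset L'$ for some $N$. If $N\ge1$,
multiplication by $x^N$ induces a map $L/xL\to L'/xL'$ that intertwines the residue shifted by $N$
with the residue. The spectra are disjoint, so this map is $0$ on every fibre, hence $0$, and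
$x^{N-1}L\subset L'$ (`pow_smul_mem_of_succ`). Descending to $N=0$ gives $L\subset L'$, and the
roles are symmetric. -/

theorem wt_pos {w : Fin n → ℕ} (hw : ∀ i, 1 ≤ w i) (i : Fin (n + 1)) : 0 < wt w i := by
  refine Fin.cases ?_ (fun j => ?_) i
  · simp [wt]
  · exact hw j

theorem mu_pos (w : Fin n → ℕ) : 0 < mu w := by simp only [mu]; omega

theorem mem_specSet {w : Fin n → ℕ} {q : ℚ ×ₗ Fin (n + 1)} :
    q ∈ specSet w ↔ ∃ (i : Fin (n + 1)) (l : ℕ), l < wt w i ∧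
      q = toLex ((l : ℚ) * mu w / wt w i, i) := by
  simp only [specSet, Finset.mem_image, Finset.mem_univ, true_and, Sigma.exists]
  constructor
  · rintro ⟨i, l, rfl⟩
    exact ⟨i, l, l.2, rfl⟩
  · rintro ⟨i, l, h, rfl⟩
    exact ⟨i, ⟨l, h⟩, rfl⟩

theorem specEnum_mem (w : Fin n → ℕ) (k : Fin (mu w)) : specEnum w k ∈ specSet w :=
  Finset.orderEmbOfFin_mem _ _ _

theorem exists_specEnum_eq {w : Fin n → ℕ} {q : ℚ ×ₗ Fin (n + 1)} (hq : q ∈ specSet w) :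
    ∃ k, specEnum w k = q := by
  have : q ∈ Set.range (specEnum w) := by
    rw [specEnum, Finset.range_orderEmbOfFin]
    exact hq
  exact this

/-- The number of indices `j < k` for which `s_j` comes from the `i`-th set. -/
def cnt (w : Fin n → ℕ) (k : ℕ) (i : Fin (n + 1)) : ℕ :=
  (Finset.univ.filter fun j : Fin (mu w) => (j : ℕ) < k ∧ idx w j = i).card

theorem specPoint_inj {w : Fin n → ℕ} {i : Fin (n + 1)} (hi : 0 < wt w i) :
    Function.Injective fun l : ℕ => toLex ((l : ℚ) * mu w / wt w i, i) := by
  intro a b h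
  have h1 := (Prod.ext_iff.1 (toLex.injective h)).1
  have hw : (wt w i : ℚ) ≠ 0 := by exact_mod_cast hi.ne'
  have hm : (mu w : ℚ) ≠ 0 := by exact_mod_cast (mu_pos w).ne'
  simp only at h1
  rw [div_left_inj' hw, mul_left_inj' hm] at h1
  exact_mod_cast h1

/-- The members of the `i`-th set are indexed by `a < wt w i`, so counting positions before `k`
reduces to counting the values `a` below `l`. -/
theorem cnt_eq_of_forall {w : Fin n → ℕ} {k l : ℕ} {i : Fin (n + 1)} (hi : 0 < wt w i)
    (hl : l ≤ wt w i)
    (h : ∀ (j : Fin (mu w)) (a : ℕ), specEnum w j = toLex ((a : ℚ) * mu w / wt w i, i) →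
      ((j : ℕ) < k ↔ a < l)) : cnt w k i = l := by
  rw [cnt, ← Finset.card_range l, ← Finset.card_image_of_injective _ (specEnum w).injective,
    ← Finset.card_image_of_injective (Finset.range l) (specPoint_inj hi)]
  congr 1
  ext q
  simp only [Finset.mem_image, Finset.mem_filter, Finset.mem_univ, true_and, Finset.mem_range]
  constructor
  · rintro ⟨j, ⟨hj, hji⟩, rfl⟩
    obtain ⟨i', a, ha, hq⟩ := mem_specSet.1 (specEnum_mem w j)
    have : i' = i := by rw [← hji, idx, hq]; rfl
    subst this
    exact ⟨a, (h j a hq).1 hj, hq.symm⟩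
  · rintro ⟨a, ha, rfl⟩
    obtain ⟨j, hj⟩ := exists_specEnum_eq (mem_specSet.2 ⟨i, a, ha.trans_le hl, rfl⟩)
    exact ⟨j, ⟨(h j a hj).2 ha, by rw [idx, hj]; rfl⟩, hj⟩

theorem cnt_mu {w : Fin n → ℕ} (hw : ∀ i, 1 ≤ w i) : cnt w (mu w) = wt w := by
  funext i
  refine cnt_eq_of_forall (wt_pos hw i) le_rfl fun j a hj => ?_
  obtain ⟨i', a', ha, hq⟩ := mem_specSet.1 (specEnum_mem w j)
  rw [hj] at hq
  obtain rfl : i = i' := (Prod.ext_iff.1 (toLex.injective hq)).2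
  obtain rfl := specPoint_inj (wt_pos hw i) hq
  simp [ha]

/-- If `s_k` is the `l`-th member of its set, its predecessors within that set are exactly those
with a smaller numerator, so `cnt` is `l`. This is what makes the exponents of the monomials match
the eigenvalues of the residue. -/
theorem cnt_idx_mul {w : Fin n → ℕ} (hw : ∀ i, 1 ≤ w i) (k : Fin (mu w)) :
    s w k * wt w (idx w k) = cnt w k (idx w k) * mu w := by
  obtain ⟨i, l, hl, hq⟩ := mem_specSet.1 (specEnum_mem w k)
  have hi : idx w k = i := by rw [idx, hq]; rfl
  have hs : s w k = (l : ℚ) * mu w / wt w i := by rw [s, hq]; rfl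
  have hwi : (0 : ℚ) < wt w i := by exact_mod_cast wt_pos hw i
  have hm : (0 : ℚ) < mu w := by exact_mod_cast mu_pos w
  rw [hi, hs, cnt_eq_of_forall (wt_pos hw i) hl.le, div_mul_cancel₀ _ hwi.ne']
  intro j a hj
  rw [← Fin.lt_def, ← (specEnum w).lt_iff_lt, hj, hq, Prod.Lex.toLex_lt_toLex]
  simp only [lt_irrefl, and_false, or_false]
  rw [div_lt_div_iff_of_pos_right hwi, mul_lt_mul_iff_of_pos_right hm]
  exact_mod_cast Iff.rfl

theorem s_nonneg (w : Fin n → ℕ) (k : Fin (mu w)) : 0 ≤ s w k := by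
  obtain ⟨i, l, hl, hq⟩ := mem_specSet.1 (specEnum_mem w k)
  have hs : s w k = (l : ℚ) * mu w / wt w i := by rw [s, hq]; rfl
  rw [hs]
  positivity

theorem s_lt_mu (w : Fin n → ℕ) (k : Fin (mu w)) : s w k < mu w := by
  obtain ⟨i, l, hl, hq⟩ := mem_specSet.1 (specEnum_mem w k)
  have hs : s w k = (l : ℚ) * mu w / wt w i := by rw [s, hq]; rfl
  have hm : (0 : ℚ) < mu w := by exact_mod_cast mu_pos w
  have hl' : (l : ℚ) < wt w i := by exact_mod_cast hl
  have h0 : (0 : ℚ) ≤ l := by positivity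
  rw [hs, div_lt_iff₀ (h0.trans_lt hl'), mul_comm (mu w : ℚ)]
  exact mul_lt_mul_of_pos_right hl' hm

theorem s_eq_zero {w : Fin n → ℕ} (hw : ∀ i, 1 ≤ w i) (k : Fin (mu w)) (hk : (k : ℕ) ≤ n) :
    s w k = 0 := by
  by_contra hne
  have hpos : 0 < s w k := lt_of_le_of_ne (s_nonneg w k) (Ne.symm hne)
  -- Each of the `n + 1` sets contains `0`; if `s_k > 0`, these `n + 1` elements all come before
  -- position `k ≤ n`.
  have hex : ∀ i : Fin (n + 1), ∃ j : Fin (mu w), specEnum w j = toLex (0, i) := fun i =>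
    exists_specEnum_eq (mem_specSet.2 ⟨i, 0, wt_pos hw i, by simp⟩)
  choose f hf using hex
  have hlt : ∀ i, (f i : ℕ) < k := fun i => by
    rw [← Fin.lt_def, ← (specEnum w).lt_iff_lt, hf, Prod.Lex.lt_iff]
    exact Or.inl hpos
  have hinj : Function.Injective fun i => (⟨f i, hlt i⟩ : Fin k) := fun a b h => by
    have h1 : f a = f b := Fin.ext (by simpa using h)
    have h2 := (hf a).symm.trans ((congrArg _ h1).trans (hf b))
    exact (Prod.ext_iff.1 (toLex.injective h2)).2
  have := Fintype.card_le_of_injective _ hinj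
  simp only [Fintype.card_fin] at this
  omega

theorem cnt_zero (w : Fin n → ℕ) : cnt w 0 = 0 := by
  funext i
  simp [cnt]

theorem cnt_succ (w : Fin n → ℕ) (k : Fin (mu w)) :
    cnt w (k + 1) = cnt w k + Pi.single (idx w k) 1 := by
  funext i
  have : (Finset.univ.filter fun j : Fin (mu w) => (j : ℕ) < k + 1 ∧ idx w j = i) =
      (Finset.univ.filter fun j : Fin (mu w) => (j : ℕ) < k ∧ idx w j = i) ∪
        (if idx w k = i then {k} else ∅) := by
    ext j
    simp only [Finset.mem_filter, Finset.mem_univ, true_and, Finset.mem_union]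
    split_ifs with h
    · rw [Finset.mem_singleton]
      constructor
      · rintro ⟨h1, h2⟩
        rcases Nat.lt_succ_iff_lt_or_eq.1 h1 with h3 | h3
        · exact Or.inl ⟨h3, h2⟩
        · exact Or.inr (Fin.ext h3)
      · rintro (⟨h1, h2⟩ | rfl)
        · exact ⟨by omega, h2⟩
        · exact ⟨by omega, h⟩
    · simp only [Finset.notMem_empty, or_false]
      refine ⟨fun ⟨h1, h2⟩ => ⟨?_, h2⟩, fun ⟨h1, h2⟩ => ⟨by omega, h2⟩⟩
      rcases Nat.lt_succ_iff_lt_or_eq.1 h1 with h3 | h3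
      · exact h3
      · exact absurd ((congrArg _ (Fin.ext h3.symm)).trans h2) h
  rw [cnt, this, Finset.card_union_of_disjoint]
  · simp only [Pi.add_apply, cnt, Pi.single_apply, eq_comm (a := i)]
    split_ifs <;> simp
  · split_ifs
    · simp
    · simp

theorem sum_cnt (w : Fin n → ℕ) {k : ℕ} (hk : k ≤ mu w) : ∑ i, cnt w k i = k := by
  induction k with
  | zero => simp [cnt_zero]
  | succ k ih =>
    have := cnt_succ w ⟨k, hk⟩
    simp only at this
    rw [this]
    simp [Finset.sum_add_distrib, ih (by omega)]

/-- The eigenvalues `s_k / μ` of the residue. -/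
def resEig (w : Fin n → ℕ) (k : Fin (mu w)) : ℂ := ((s w k / mu w : ℚ) : ℂ)

theorem resEig_mul_wt {w : Fin n → ℕ} (hw : ∀ i, 1 ≤ w i) (k : Fin (mu w)) :
    resEig w k * wt w (idx w k) = cnt w k (idx w k) := by
  have hm : (mu w : ℚ) ≠ 0 := by exact_mod_cast (mu_pos w).ne'
  have h := cnt_idx_mul hw k
  have : s w k / mu w * wt w (idx w k) = cnt w k (idx w k) := by
    field_simp
    linarith
  rw [resEig]
  exact_mod_cast congrArg (fun q : ℚ => (q : ℂ)) this

theorem RPhi_eq {w : Fin n → ℕ} (hw : ∀ i, 1 ≤ w i) : RPhi w = Matrix.diagonal (resEig w) := by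
  unfold RPhi resEig
  congr 1
  funext k
  split_ifs with h
  · simp [s_eq_zero hw k h]
  · rfl

theorem alpha_eq (w : Fin n → ℕ) (k : Fin (mu w)) :
    ((alpha w k : ℚ) : ℂ) = (k : ℕ) - mu w * resEig w k := by
  have hm : (mu w : ℚ) ≠ 0 := by exact_mod_cast (mu_pos w).ne'
  have : alpha w k = (k : ℕ) - mu w * (s w k / mu w) := by rw [alpha]; field_simp
  rw [this, resEig]
  push_cast
  ring

/-! ### Columns of the matrices -/

section Columns

variable {V : Type} [AddCommGroup V]

/-- The vector that follows `v k`: it is `v (k + 1)`, or `x / (w₁^{w₁} ⋯ wₙ^{wₙ}) • v 0` if `k`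
is the last index. -/
def nextVec [Module RLog V] [Module ℂ V] (w : Fin n → ℕ) (v : Fin (mu w) → V) (k : Fin (mu w)) :
    V :=
  if h : (k : ℕ) + 1 < mu w then v ⟨k + 1, h⟩
  else ((∏ l, (w l : ℂ) ^ w l)⁻¹ : ℂ) • (Polynomial.X : RLog) • v ⟨0, mu_pos w⟩

variable [Module RLog V] [Module RTau V] [Module ℂ V] [IsScalarTower RTau RLog V]
  [IsScalarTower ℂ RLog V] [IsScalarTower ℂ RTau V]

omit [Module RTau V] [IsScalarTower RTau RLog V] [IsScalarTower ℂ RTau V] in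
theorem sum_A0Phi_smul (w : Fin n → ℕ) (v : Fin (mu w) → V) (k : Fin (mu w)) :
    ∑ i, A0Phi w i k • v i = (mu w : ℂ) • nextVec w v k := by
  have hnat : ∀ a : V, (mu w : RLog) • a = (mu w : ℂ) • a := fun a => by
    rw [Nat.cast_smul_eq_nsmul, Nat.cast_smul_eq_nsmul]
  rw [nextVec]
  split_ifs with h
  · rw [Finset.sum_eq_single ⟨k + 1, h⟩]
    · simp [A0Phi, hnat]
    · intro i _ hi
      have h1 : (i : ℕ) ≠ k + 1 := fun h' => hi (Fin.ext h')
      have h2 : (k : ℕ) + 1 ≠ mu w := h.ne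
      simp [A0Phi, h1, h2]
    · simp
  · have hk : (k : ℕ) + 1 = mu w := by have := k.2; omega
    rw [Finset.sum_eq_single ⟨0, mu_pos w⟩]
    · simp only [A0Phi, hk, and_self, if_true]
      rw [if_neg (mu_pos w).ne, mul_smul, algebraMap_smul, smul_smul, div_eq_mul_inv]
    · intro i _ hi
      have h1 : (i : ℕ) ≠ 0 := fun h' => hi (Fin.ext h')
      have h2 : (i : ℕ) ≠ k + 1 := by have := i.2; omega
      simp [A0Phi, h1, h2]
    · simp

omit [Module RTau V] [IsScalarTower RTau RLog V] [IsScalarTower ℂ RTau V] in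
theorem sum_diagonal_smul (w : Fin n → ℕ) (d : Fin (mu w) → ℂ) (v : Fin (mu w) → V)
    (k : Fin (mu w)) :
    ∑ i, ((Matrix.diagonal d).map (algebraMap ℂ RLog)) i k • v i = d k • v k := by
  rw [Finset.sum_eq_single k]
  · rw [Matrix.map_apply, Matrix.diagonal_apply_eq, algebraMap_smul]
  · intro i _ hi
    simp [Matrix.diagonal_apply_ne _ hi]
  · simp

omit [Module ℂ V] [IsScalarTower ℂ RLog V] [IsScalarTower ℂ RTau V] in
theorem C_smul (r : RTau) (a : V) : (Polynomial.C r : RLog) • a = r • a :=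
  algebraMap_smul RLog r a

/-- Stated for an arbitrary module because it is applied both to the Gauss-Manin system and to the
free model. -/
theorem sum_matX_smul {w : Fin n → ℕ} (hw : ∀ i, 1 ≤ w i) (v : Fin (mu w) → V)
    (k : Fin (mu w)) :
    ∑ i, matX w i k • v i = resEig w k • v k - (T 1 : RTau) • nextVec w v k := by
  have hm : (mu w : ℂ) ≠ 0 := by exact_mod_cast (mu_pos w).ne'
  simp only [matX, Matrix.add_apply, Matrix.neg_apply, Matrix.smul_apply, add_smul, neg_smul,
    Finset.sum_add_distrib, Finset.sum_neg_distrib, smul_eq_mul, mul_smul, ← Finset.smul_sum,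
    sum_A0Phi_smul]
  rw [RPhi_eq hw, sum_diagonal_smul, C_smul, smul_assoc, smul_comm (thetaInv), smul_smul,
    inv_mul_cancel₀ hm, one_smul, thetaInv]
  abel

/-- Because `α_k = k - μ (s_k / μ)`, the matrix of `∇_{∂_θ}` is `τ (diag(k) - μ · matX)`, which
mirrors the homogeneity formula `nablaTheta_vmon`. -/
theorem sum_matTheta_smul (w : Fin n → ℕ) (v : Fin (mu w) → V) (k : Fin (mu w)) :
    ∑ i, matTheta w i k • v i = (T 1 : RTau) • (((k : ℕ) : ℂ) • v k -
      (mu w : ℂ) • (resEig w k • v k - (T 1 : RTau) • nextVec w v k)) := by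
  simp only [matTheta, Matrix.add_apply, Matrix.smul_apply, add_smul,
    Finset.sum_add_distrib, smul_eq_mul, mul_smul, ← Finset.smul_sum,
    sum_A0Phi_smul]
  rw [AInfty, sum_diagonal_smul, C_smul, C_smul, alpha_eq, thetaInv, pow_two, mul_smul, sub_smul,
    mul_smul, smul_comm (T 1 : RTau) (mu w : ℂ) (nextVec w v k)]
  rw [← smul_add]
  congr 1
  simp only [smul_sub]
  abel

end Columns

/-! ### Relations in the Gauss-Manin system -/

/-- The class of an `n`-form as a linear map in the coefficient of `du₁/u₁ ∧ ⋯ ∧ duₙ/uₙ`. -/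
def classLin (w : Fin n → ℕ) : Coord n →ₗ[RTot] GM w :=
  mkGM w ∘ₗ LinearMap.pi fun _ => LinearMap.id

theorem classLin_apply (w : Fin n → ℕ) (g : Coord n) : classLin w g = classOf w g := rfl

theorem subset_eq_univ (S : {S : Finset (Fin n) // S.card = n}) : S.1 = Finset.univ :=
  Finset.eq_univ_of_card _ (by simpa using S.2)

theorem classLin_surjective (w : Fin n → ℕ) : Function.Surjective (classLin w) := by
  intro m
  obtain ⟨η, rfl⟩ := mkGM_surjective w m
  refine ⟨η ⟨Finset.univ, by simp⟩, ?_⟩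
  rw [classLin_apply, classOf]
  congr 1
  funext S
  congr 1
  exact Subtype.ext (subset_eq_univ S).symm

/-- The operators `u_i ∂/∂u_i - τ (u_i ∂F/∂u_i)` whose images span the relations. -/
def relOp (w : Fin n → ℕ) (i : Fin n) : Coord n →ₗ[RTot] Coord n :=
  (dLogU i : Coord n →ₗ[RTot] Coord n) -
    (algebraMap RTau RTot (T 1)) • LinearMap.mulLeft RTot (dLogU i (F w))

theorem relations_apply (w : Fin n → ℕ) (ξ : LogForm n (n - 1))
    (S : {S : Finset (Fin n) // S.card = n}) :
    (extD n (n - 1) n - (algebraMap RTau RTot (T 1)) • dWedge (F w) (n - 1) n) ξ S =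
      ∑ i, ((-1 : ℤ) ^ (Finset.univ.filter (· < i)).card) •
        relOp w i (LogForm.coeffAt (n - 1) (Finset.univ.erase i) ξ) := by
  simp only [extD, dWedge, LinearMap.sub_apply, LinearMap.smul_apply, Pi.sub_apply, Pi.smul_apply,
    wedgeWith_apply, Finset.smul_sum, ← Finset.sum_sub_distrib, subset_eq_univ S, relOp]
  refine Finset.sum_congr rfl fun i _ => ?_
  rw [smul_comm, ← smul_sub]

theorem classLin_relOp (w : Fin n → ℕ) (i : Fin n) (g : Coord n) :
    classLin w (relOp w i g) = 0 := by
  refine (Submodule.Quotient.mk_eq_zero (relations w)).2 ?_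
  -- The form is supported on the only `(n - 1)`-subset avoiding `i`; its sign cancels the sign in
  -- the wedge product.
  refine ⟨fun S => if i ∈ S.1 then 0 else
    ((-1 : ℤ) ^ (Finset.univ.filter (· < i)).card) • g, ?_⟩
  funext S
  rw [relations_apply, Finset.sum_eq_single i]
  · have hc : (Finset.univ.erase i : Finset (Fin n)).card = n - 1 := by simp
    rw [LogForm.coeffAt, dif_pos hc, LinearMap.proj_apply, if_neg (by simp), map_zsmul, smul_smul,
      ← mul_pow]
    simp
  · intro j _ hj
    have hc : (Finset.univ.erase j : Finset (Fin n)).card = n - 1 := by simp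
    rw [LogForm.coeffAt, dif_pos hc, LinearMap.proj_apply,
      if_pos (Finset.mem_erase.2 ⟨hj.symm, Finset.mem_univ _⟩), map_zero, smul_zero]
  · simp

/-- A linear map on functions that kills the images of the operators `relOp` induces a map on
the Gauss-Manin system. -/
theorem exists_lift {V : Type} [AddCommGroup V] [Module RTot V] (w : Fin n → ℕ)
    (f : Coord n →ₗ[RTot] V) (hf : ∀ i g, f (relOp w i g) = 0) :
    ∃ φ : GM w →ₗ[RTot] V, ∀ g, φ (classOf w g) = f g := by
  refine ⟨(relations w).liftQ (f ∘ₗ LinearMap.proj ⟨Finset.univ, by simp⟩) ?_, fun g => rfl⟩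
  rintro _ ⟨ξ, rfl⟩
  rw [LinearMap.mem_ker, LinearMap.comp_apply, LinearMap.proj_apply, relations_apply, map_sum]
  exact Finset.sum_eq_zero fun i _ => by rw [map_zsmul, hf, smul_zero]

/-! ### Monomials -/

/-- The monomial `∏ v_i^{c_i}` in the terms `v_0, …, v_n` of `F`. -/
def vmon (w : Fin n → ℕ) (c : Fin (n + 1) → ℕ) : Coord n := ∏ i, term w i ^ c i

theorem vmon_zero (w : Fin n → ℕ) : vmon w 0 = 1 := by simp [vmon]

theorem vmon_add_single (w : Fin n → ℕ) (c : Fin (n + 1) → ℕ) (i : Fin (n + 1)) :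
    vmon w (c + Pi.single i 1) = term w i * vmon w c := by
  simp only [vmon, Pi.add_apply, pow_add, Finset.prod_mul_distrib]
  rw [mul_comm]
  congr 1
  rw [Finset.prod_eq_single i]
  · simp
  · intro j _ hj
    simp [hj]
  · simp

theorem vmon_eq (w : Fin n → ℕ) (c : Fin (n + 1) → ℕ) :
    vmon w c = AddMonoidAlgebra.single (fun i => (c i.succ : ℤ) - c 0 * w i) (T (c 0)) := by
  rw [vmon, Fin.prod_univ_succ]
  have h1 : ∏ i : Fin n, term w i.succ ^ c i.succ =
      (AddMonoidAlgebra.single (fun i => (c i.succ : ℤ)) 1 : Coord n) := by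
    simp only [term, Fin.cons_succ, u, AddMonoidAlgebra.single_pow, one_pow,
      AddMonoidAlgebra.prod_single, Finset.prod_const_one]
    congr 1
    funext j
    simp [Finset.sum_apply, Pi.single_apply]
  rw [h1]
  simp only [term, Fin.cons_zero, u0, AddMonoidAlgebra.smul_single, AddMonoidAlgebra.single_pow,
    AddMonoidAlgebra.single_mul_single, smul_eq_mul, mul_one]
  congr 1
  · funext i
    simp
    ring
  · simp [T_pow]


/-! ### The connection on monomials -/

theorem dLogU_vmon (w : Fin n → ℕ) (i : Fin n) (c : Fin (n + 1) → ℕ) :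
    dLogU i (vmon w c) = ((c i.succ : ℂ) - c 0 * w i) • vmon w c := by
  rw [vmon_eq, dLogU_single, AddMonoidAlgebra.smul_single]
  congr 1
  rw [Algebra.smul_def]
  simp

theorem dLogU_F (w : Fin n → ℕ) (i : Fin n) :
    dLogU i (F w) = term w i.succ - (w i : ℂ) • term w 0 := by
  have h1 : dLogU i (u0 w) = -((w i : ℂ) • u0 w) := by
    rw [u0, dLogU_single, AddMonoidAlgebra.smul_single, ← AddMonoidAlgebra.single_neg]
    congr 1
    rw [Algebra.smul_def]
    simp
  have h2 : ∀ j, dLogU i (u j : Coord n) = if j = i then u i else 0 := fun j => by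
    rw [u, dLogU_single]
    split_ifs with h
    · subst h
      simp [u]
    · simp [Ne.symm h]
  simp only [F, map_add, map_sum, Derivation.map_smul, h1, h2, Finset.sum_ite_eq', Finset.mem_univ,
    if_true, term, Fin.cons_zero, Fin.cons_succ, smul_neg]
  rw [smul_comm, sub_eq_add_neg]

theorem F_eq_sum_term (w : Fin n → ℕ) : F w = ∑ i, term w i := by
  rw [Fin.sum_univ_succ, F, add_comm]
  simp [term]

theorem x_dX_F (w : Fin n → ℕ) : (T 1 : RTot) • dX n (F w) = term w 0 := by
  have h1 : dX n (u0 w) = 0 := by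
    rw [u0, dX_single, Derivation.map_one_eq_zero, AddMonoidAlgebra.single_zero]
  have h2 : ∀ j, dX n (u j : Coord n) = 0 := fun j => by
    rw [u, dX_single, Derivation.map_one_eq_zero, AddMonoidAlgebra.single_zero]
  have h3 : dX₁ (T 1) = 1 := by
    rw [dX₁, T, laurentDer_single]
    simp
  simp [F, dX_smul, h1, h2, h3, term]

theorem x_dX_vmon (w : Fin n → ℕ) (c : Fin (n + 1) → ℕ) :
    (T 1 : RTot) • dX n (vmon w c) = (c 0 : ℂ) • vmon w c := by
  rw [vmon_eq, dX_single, AddMonoidAlgebra.smul_single, AddMonoidAlgebra.smul_single, dX₁, T, T,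
    laurentDer_single, smul_eq_mul, AddMonoidAlgebra.single_mul_single,
    AddMonoidAlgebra.smul_single]
  congr 1
  rw [Algebra.smul_def]
  simp

theorem dTau_vmon (w : Fin n → ℕ) (c : Fin (n + 1) → ℕ) : dTau n (vmon w c) = 0 := by
  rw [vmon_eq, dTau_single, dTau₁, coeffDer, T, monomialDer_single]
  simp

theorem nablaX_classOf (w : Fin n → ℕ) (g : Coord n) :
    nablaX w (classOf w g) = classOf w (dX n g - (T 1 : RTau) • (dX n (F w) * g)) := rfl

theorem nablaTau_classOf (w : Fin n → ℕ) (g : Coord n) :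
    nablaTau w (classOf w g) = classOf w (dTau n g - F w * g) := rfl

theorem classOf_smul (w : Fin n → ℕ) (r : RTot) (g : Coord n) :
    classOf w (r • g) = r • classOf w g := map_smul (classLin w) r g

theorem classOf_smul_tau (w : Fin n → ℕ) (r : RTau) (g : Coord n) :
    classOf w (r • g) = r • classOf w g := by
  rw [← algebraMap_smul RTot r g, classOf_smul, algebraMap_smul]

theorem classOf_smul_complex (w : Fin n → ℕ) (r : ℂ) (g : Coord n) :
    classOf w (r • g) = r • classOf w g := by
  rw [← algebraMap_smul RTau r g, classOf_smul_tau, algebraMap_smul]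

theorem classOf_sub (w : Fin n → ℕ) (f g : Coord n) :
    classOf w (f - g) = classOf w f - classOf w g := map_sub (classLin w) f g

theorem classOf_sum {ι : Type} (w : Fin n → ℕ) (t : Finset ι) (f : ι → Coord n) :
    classOf w (∑ i ∈ t, f i) = ∑ i ∈ t, classOf w (f i) := map_sum (classLin w) f t

theorem xNablaX_vmon (w : Fin n → ℕ) (c : Fin (n + 1) → ℕ) :
    xNablaX w (classOf w (vmon w c)) = (c 0 : ℂ) • classOf w (vmon w c) -
      (T 1 : RTau) • classOf w (term w 0 * vmon w c) := by
  rw [xNablaX, LinearMap.smul_apply, nablaX_classOf, ← classOf_smul, smul_sub, x_dX_vmon,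
    smul_comm, ← smul_mul_assoc, x_dX_F, classOf_sub, classOf_smul_complex, classOf_smul_tau]

theorem relOp_vmon (w : Fin n → ℕ) (i : Fin n) (c : Fin (n + 1) → ℕ) :
    relOp w i (vmon w c) = ((c i.succ : ℂ) - c 0 * w i) • vmon w c -
      (T 1 : RTau) • (term w i.succ * vmon w c - (w i : ℂ) • (term w 0 * vmon w c)) := by
  rw [relOp, LinearMap.sub_apply, LinearMap.smul_apply, LinearMap.mulLeft_apply, algebraMap_smul,
    Derivation.coeFn_coe, dLogU_vmon, dLogU_F, sub_mul, smul_mul_assoc]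

/-- For `i = 0` this is the formula for `x ∇_{∂_x}`, since `x ∂F/∂x = v₀`. For the other indices,
the relation given by `u_i ∂/∂u_i` expresses `v_i` through `v₀`, and the case `i = 0` eliminates
`v₀`. -/
theorem tau_smul_term_mul (w : Fin n → ℕ) (i : Fin (n + 1)) (c : Fin (n + 1) → ℕ) :
    (T 1 : RTau) • classOf w (term w i * vmon w c) = (c i : ℂ) • classOf w (vmon w c) -
      (wt w i : ℂ) • xNablaX w (classOf w (vmon w c)) := by
  refine Fin.cases ?_ (fun i => ?_) i
  · rw [xNablaX_vmon]
    simp [wt]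
  · have h := classLin_relOp w i (vmon w c)
    rw [relOp_vmon, classLin_apply, classOf_sub, classOf_smul_complex, classOf_smul_tau,
      classOf_sub, classOf_smul_complex, sub_eq_zero, smul_sub, smul_comm (T 1 : RTau) (w i : ℂ),
      eq_sub_iff_add_eq] at h
    rw [xNablaX_vmon, ← h, wt, Fin.cons_succ]
    generalize (T 1 : RTau) • classOf w (term w 0 * vmon w c) = a
    generalize classOf w (vmon w c) = b
    module

theorem theta_tau_smul {V : Type} [AddCommGroup V] [Module RTau V] (v : V) :
    (T (-1) : RTau) • (T 1 : RTau) • v = v := by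
  rw [smul_smul, ← T_add]
  simp

theorem term_mul (w : Fin n → ℕ) (i : Fin (n + 1)) (c : Fin (n + 1) → ℕ) :
    classOf w (term w i * vmon w c) = (T (-1) : RTau) • ((c i : ℂ) • classOf w (vmon w c) -
      (wt w i : ℂ) • xNablaX w (classOf w (vmon w c))) := by
  rw [← tau_smul_term_mul, theta_tau_smul]

theorem sum_wt (w : Fin n → ℕ) : ∑ i, wt w i = mu w := by
  simp [mu, wt, Fin.sum_univ_succ]

/-- Monomials do not involve `τ`, so `∇_{∂_θ}` is multiplication by `τ² F`. As `F = ∑ v_i` and `∑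
w_i = μ`, one factor `τ` is absorbed by adding up `tau_smul_term_mul` over all `i`. -/
theorem nablaTheta_vmon (w : Fin n → ℕ) (c : Fin (n + 1) → ℕ) :
    nablaTheta w (classOf w (vmon w c)) = (T 1 : RTau) • (((∑ i, c i : ℕ) : ℂ) •
      classOf w (vmon w c) - (mu w : ℂ) • xNablaX w (classOf w (vmon w c))) := by
  have h2 : (-T 2 : RTau) = T 1 * -T 1 := by rw [mul_neg, ← T_add]; norm_num
  rw [nablaTheta, LinearMap.smul_apply, nablaTau_classOf, dTau_vmon, classOf_sub, h2, mul_smul,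
    F_eq_sum_term, Finset.sum_mul, classOf_sum, ← sum_wt, neg_smul, ← smul_neg, neg_sub]
  congr 1
  have h0 : classOf w 0 = 0 := map_zero (classLin w)
  rw [h0, sub_zero, Finset.smul_sum]
  simp only [tau_smul_term_mul, Finset.sum_sub_distrib, ← Finset.sum_smul, Nat.cast_sum]

/-! ### The sections `ω^φ_k` generate the Gauss-Manin system -/

/-- An integer `N` for which `a + N w` is non-negative. -/
def shiftExp (a : Fin n → ℤ) : ℕ := ∑ i, (a i).natAbs

theorem shiftExp_spec {w : Fin n → ℕ} (hw : ∀ i, 1 ≤ w i) (a : Fin n → ℤ) (i : Fin n) :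
    0 ≤ a i + shiftExp a * w i := by
  have h1 : (a i).natAbs ≤ shiftExp a :=
    Finset.single_le_sum (f := fun i => (a i).natAbs) (fun _ _ => Nat.zero_le _)
      (Finset.mem_univ i)
  have h2 : (a i).natAbs ≤ shiftExp a * w i := h1.trans (Nat.le_mul_of_pos_right _ (hw i))
  have h3 : ((a i).natAbs : ℤ) ≤ (shiftExp a : ℤ) * w i := by exact_mod_cast h2
  omega

/-- Exponents `c` for which `∏ v_i^{c_i}` is `x^N u^a`, where `N = shiftExp a`. -/
def liftExp (w : Fin n → ℕ) (a : Fin n → ℤ) : Fin (n + 1) → ℕ :=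
  Fin.cons (shiftExp a) fun i => (a i + shiftExp a * w i).toNat

/-- Multiplying by a power of `v₀ ∏ v_i^{w_i} = x` makes all exponents non-negative, because every
`w_i` is positive; `x` is invertible, so nothing is lost. -/
theorem single_eq_smul_vmon {w : Fin n → ℕ} (hw : ∀ i, 1 ≤ w i) (a : Fin n → ℤ) (r : RTot) :
    AddMonoidAlgebra.single a r = (r * T (-(shiftExp a : ℤ))) • vmon w (liftExp w a) := by
  rw [vmon_eq, AddMonoidAlgebra.smul_single, smul_eq_mul, mul_assoc, liftExp, Fin.cons_zero,
    ← T_add, neg_add_cancel, T_zero, mul_one]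
  congr 1
  funext i
  have := Int.toNat_of_nonneg (shiftExp_spec hw a i)
  rw [Fin.cons_succ]
  omega

theorem span_vmon {w : Fin n → ℕ} (hw : ∀ i, 1 ≤ w i) :
    Submodule.span RTot (Set.range (vmon w)) = ⊤ := by
  rw [eq_top_iff]
  rintro g -
  induction g using AddMonoidAlgebra.induction_linear with
  | zero => exact zero_mem _
  | add f g hf hg => exact add_mem hf hg
  | single a r =>
    rw [single_eq_smul_vmon hw]
    exact Submodule.smul_mem _ _ (Submodule.subset_span ⟨_, rfl⟩)

/-- The product of the weights `w_{i(j)}` for `j < k`. -/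
def wprod (w : Fin n → ℕ) (k : ℕ) : ℂ :=
  ∏ j ∈ Finset.univ.filter fun j : Fin (mu w) => (j : ℕ) < k, (wt w (idx w j) : ℂ)

theorem filter_lt_succ {m : ℕ} (k : Fin m) :
    (Finset.univ.filter fun j : Fin m => (j : ℕ) < k + 1) =
      insert k (Finset.univ.filter fun j : Fin m => (j : ℕ) < k) := by
  ext j
  simp only [Finset.mem_filter, Finset.mem_univ, true_and, Finset.mem_insert, Fin.ext_iff]
  omega

theorem wprod_succ (w : Fin n → ℕ) (k : Fin (mu w)) :
    wprod w (k + 1) = wt w (idx w k) * wprod w k := by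
  rw [wprod, filter_lt_succ, Finset.prod_insert (by simp), wprod]

theorem wprod_ne_zero {w : Fin n → ℕ} (hw : ∀ i, 1 ≤ w i) (k : ℕ) : wprod w k ≠ 0 :=
  Finset.prod_ne_zero_iff.2 fun j _ => by exact_mod_cast (wt_pos hw _).ne'

theorem wprod_mu {w : Fin n → ℕ} (hw : ∀ i, 1 ≤ w i) : wprod w (mu w) = ∏ l, (w l : ℂ) ^ w l := by
  have h : wprod w (mu w) = ∏ i, (wt w i : ℂ) ^ cnt w (mu w) i := by
    rw [wprod, ← Finset.prod_fiberwise_of_maps_to (g := idx w) (t := Finset.univ) (by simp)]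
    refine Finset.prod_congr rfl fun i _ => ?_
    rw [Finset.prod_congr rfl (g := fun _ => (wt w i : ℂ)), Finset.prod_const, Finset.filter_filter]
    · rfl
    · intro j hj
      rw [(Finset.mem_filter.1 hj).2]
  rw [h, cnt_mu hw, Fin.prod_univ_succ]
  simp [wt]

/-- The sections `ω^φ_k`, for `0 ≤ k ≤ μ`. -/
def omegaNat (w : Fin n → ℕ) (k : ℕ) : GM w := (wprod w k)⁻¹ • classOf w (vmon w (cnt w k))

theorem prod_term (w : Fin n → ℕ) {k : ℕ} (hk : k ≤ mu w) :
    ∏ j ∈ Finset.univ.filter fun j : Fin (mu w) => (j : ℕ) < k,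
        ((wt w (idx w j) : ℂ)⁻¹ • term w (idx w j)) =
      (wprod w k)⁻¹ • vmon w (cnt w k) := by
  induction k with
  | zero => simp [wprod, cnt_zero, vmon_zero]
  | succ k ih =>
    have h1 := cnt_succ w ⟨k, hk⟩
    have h2 := wprod_succ w ⟨k, hk⟩
    have h3 := filter_lt_succ (⟨k, hk⟩ : Fin (mu w))
    simp only at h1 h2 h3
    rw [h1, h2, h3, vmon_add_single, Finset.prod_insert (by simp), ih (by omega), mul_inv,
      smul_mul_smul_comm]

theorem omegaPhi_eq (w : Fin n → ℕ) (k : Fin (mu w)) : omegaPhi w k = omegaNat w k := by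
  rw [omegaPhi, omegaNat, ← classOf_smul_complex, ← prod_term w k.2.le]
  congr 2
  ext j
  simp

/-- This is the relation `v₀ ∏ v_i^{w_i} = x`, responsible for the upper right entry of `A₀^φ`. -/
theorem vmon_wt (w : Fin n → ℕ) : vmon w (wt w) = (T 1 : RTot) • vmon w 0 := by
  rw [vmon_eq, vmon_zero, AddMonoidAlgebra.one_def, AddMonoidAlgebra.smul_single]
  congr 1
  · funext i
    simp [wt]
  · simp [wt]

theorem omegaNat_mu {w : Fin n → ℕ} (hw : ∀ i, 1 ≤ w i) :
    omegaNat w (mu w) =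
      ((∏ l, (w l : ℂ) ^ w l)⁻¹ : ℂ) • (Polynomial.X : RLog) • omegaNat w 0 := by
  rw [omegaNat, cnt_mu hw, wprod_mu hw, vmon_wt, classOf_smul, X_smul, omegaNat, cnt_zero]
  simp [wprod]

theorem nextVec_omegaPhi {w : Fin n → ℕ} (hw : ∀ i, 1 ≤ w i) (k : Fin (mu w)) :
    nextVec w (omegaPhi w) k = omegaNat w (k + 1) := by
  rw [nextVec]
  split_ifs with h
  · rw [omegaPhi_eq]
  · have hk : (k : ℕ) + 1 = mu w := by have := k.2; omega
    rw [omegaPhi_eq, hk, omegaNat_mu hw]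

theorem smul_xNablaX (w : Fin n → ℕ) (c : ℂ) (m : GM w) :
    xNablaX w (c • m) = c • xNablaX w m := by
  rw [← algebraMap_smul RTau c m, map_smul, algebraMap_smul]

/-- The relation `tau_smul_term_mul` for the index `i(k)`, divided by `w_{i(k)}`: the quotient `c_i
/ w_i` is the eigenvalue `s_k / μ` by `resEig_mul_wt`. -/
theorem tau_smul_omegaNat_succ {w : Fin n → ℕ} (hw : ∀ i, 1 ≤ w i) (k : Fin (mu w)) :
    (T 1 : RTau) • omegaNat w (k + 1) =
      resEig w k • omegaNat w k - xNablaX w (omegaNat w k) := by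
  have hi : (wt w (idx w k) : ℂ) ≠ 0 := by exact_mod_cast (wt_pos hw _).ne'
  rw [omegaNat, cnt_succ, wprod_succ, vmon_add_single, smul_comm, tau_smul_term_mul,
    ← resEig_mul_wt hw, omegaNat, smul_xNablaX, mul_inv,
    mul_comm, mul_smul, smul_comm _ (wprod w k)⁻¹, ← smul_sub]
  congr 1
  rw [mul_comm, mul_smul, ← smul_sub, smul_smul, inv_mul_cancel₀ hi, one_smul]

theorem xNablaX_omegaPhi {w : Fin n → ℕ} (hw : ∀ i, 1 ≤ w i) (k : Fin (mu w)) :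
    xNablaX w (omegaPhi w k) = ∑ i, matX w i k • omegaPhi w i := by
  rw [sum_matX_smul hw, nextVec_omegaPhi hw, tau_smul_omegaNat_succ hw, omegaPhi_eq, sub_sub_cancel]

theorem complex_smul_nablaTheta (w : Fin n → ℕ) (c : ℂ) (m : GM w) :
    nablaTheta w (c • m) = c • nablaTheta w m := map_smul _ _ _

theorem nablaTheta_omegaPhi {w : Fin n → ℕ} (hw : ∀ i, 1 ≤ w i) (k : Fin (mu w)) :
    nablaTheta w (omegaPhi w k) = ∑ i, matTheta w i k • omegaPhi w i := by
  rw [sum_matTheta_smul, nextVec_omegaPhi hw, tau_smul_omegaNat_succ hw, omegaPhi_eq,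
    sub_sub_cancel, omegaNat, complex_smul_nablaTheta, nablaTheta_vmon, sum_cnt w k.2.le,
    smul_xNablaX, smul_comm, smul_sub, smul_comm _ (wprod w k)⁻¹, smul_comm _ (wprod w k)⁻¹]

theorem xNablaX_smul (w : Fin n → ℕ) (r : RTot) (m : GM w) :
    xNablaX w (r • m) = (T 1 * dX₁ r) • m + r • xNablaX w m := by
  rw [xNablaX, LinearMap.smul_apply, nablaX_smul, smul_add, smul_smul, LinearMap.smul_apply,
    smul_comm r]

/-- The span is stable under `x ∇_{∂_x}` and contains the class of `1`. By `term_mul`, multiplying a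
monomial by a term of `F` only uses `x ∇_{∂_x}` and scalars, so induction on the degree reaches
every monomial. -/
theorem span_omegaPhi {w : Fin n → ℕ} (hw : ∀ i, 1 ≤ w i) :
    Submodule.span RTot (Set.range (omegaPhi w)) = ⊤ := by
  set W := Submodule.span RTot (Set.range (omegaPhi w)) with hW
  have hlog : ∀ (r : RLog) (m : GM w), m ∈ W → r • m ∈ W := fun r m hm => by
    rw [← algebraMap_smul RTot r m]
    exact W.smul_mem _ hm
  have htau : ∀ (r : RTau) (m : GM w), m ∈ W → r • m ∈ W := fun r m hm => by
    rw [← algebraMap_smul RTot r m]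
    exact W.smul_mem _ hm
  have hC : ∀ (r : ℂ) (m : GM w), m ∈ W → r • m ∈ W := fun r m hm => by
    rw [← algebraMap_smul RTau r m]
    exact htau _ _ hm
  have hE : ∀ m ∈ W, xNablaX w m ∈ W := fun m hm => by
    induction hm using Submodule.span_induction with
    | mem m hm =>
      obtain ⟨k, rfl⟩ := hm
      rw [xNablaX_omegaPhi hw]
      exact sum_mem fun i _ => hlog _ _ (Submodule.subset_span ⟨i, rfl⟩)
    | zero => rw [map_zero]; exact zero_mem _
    | add a b _ _ ha hb => rw [map_add]; exact add_mem ha hb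
    | smul r a ha' ha =>
      rw [xNablaX_smul]
      exact add_mem (W.smul_mem _ ha') (W.smul_mem _ ha)
  have h0 : classOf w (vmon w 0) ∈ W := by
    have : classOf w (vmon w 0) = omegaPhi w ⟨0, mu_pos w⟩ := by
      rw [omegaPhi_eq, omegaNat, cnt_zero]
      simp [wprod]
    rw [this]
    exact Submodule.subset_span ⟨_, rfl⟩
  have hmon : ∀ (d : ℕ) (c : Fin (n + 1) → ℕ), ∑ i, c i = d → classOf w (vmon w c) ∈ W := by
    intro d
    induction d with
    | zero =>
      intro c hc
      have : c = 0 := by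
        funext i
        exact (Finset.sum_eq_zero_iff.1 hc) i (Finset.mem_univ i)
      rw [this]
      exact h0
    | succ d ih =>
      intro c hc
      obtain ⟨i, -, hi⟩ := Finset.exists_ne_zero_of_sum_ne_zero (hc.trans_ne d.succ_ne_zero)
      have hci : c = (c - Pi.single i 1) + Pi.single i 1 := by
        funext j
        by_cases h : j = i
        · subst h
          simp
          omega
        · simp [h]
      have hs := congrArg (fun c => ∑ i, c i) hci
      simp only [Pi.add_apply, Finset.sum_add_distrib, Finset.sum_pi_single', Finset.mem_univ,
        if_true, hc] at hs
      rw [hci, vmon_add_single, term_mul]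
      have h1 : ∑ j, (Pi.single i 1 : Fin (n + 1) → ℕ) j = 1 := by simp [Pi.single_apply]
      have := ih (c - Pi.single i 1) (by omega)
      exact htau _ _ (sub_mem (hC _ _ this) (hC _ _ (hE _ this)))
  rw [eq_top_iff]
  rintro m -
  obtain ⟨g, rfl⟩ := classLin_surjective w m
  have hg : g ∈ Submodule.span RTot (Set.range (vmon w)) := by rw [span_vmon hw]; trivial
  induction hg using Submodule.span_induction with
  | mem g hg => obtain ⟨c, rfl⟩ := hg; exact hmon _ c rfl
  | zero => rw [map_zero]; exact zero_mem _
  | add a b _ _ ha hb => rw [map_add]; exact add_mem ha hb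
  | smul r a _ ha => rw [map_smul]; exact W.smul_mem _ ha

/-! ### The hypergeometric model -/

theorem aeval_comm_of_comm {R V W : Type} [CommRing R] [AddCommGroup V]
    [AddCommGroup W] [Module R V] [Module R W] (f : V →ₗ[R] W) (A : Module.End R W)
    (B : Module.End R V) (h : ∀ v, A (f v) = f (B v)) (p : Polynomial R) (v : V) :
    Polynomial.aeval A p (f v) = f (Polynomial.aeval B p v) := by
  induction p using Polynomial.induction_on generalizing v with
  | C a => simp
  | add p q hp hq => simp [hp, hq]
  | monomial k a ih =>
    rw [pow_succ, ← mul_assoc, map_mul _ _ Polynomial.X, map_mul _ _ Polynomial.X,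
      Polynomial.aeval_X, Polynomial.aeval_X, Module.End.mul_apply, Module.End.mul_apply, h, ih]

/-- The free module of rank `μ` on which the hypergeometric connection is constructed. -/
abbrev Model (w : Fin n → ℕ) : Type := Fin (mu w) → RTot

instance (w : Fin n → ℕ) : IsScalarTower ℂ RLog (Model w) :=
  ⟨fun c p m => by
    rw [← algebraMap_smul RTau c p, smul_assoc, algebraMap_smul]⟩

/-- The derivation `x ∂/∂x`. -/
def xDer : Derivation RTau RTot RTot := (T 1 : RTot) • dX₁

theorem xDer_T_one : xDer (T 1) = T 1 := by
  rw [xDer, Derivation.smul_apply, dX₁, T, laurentDer_single, smul_eq_mul,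
    AddMonoidAlgebra.single_mul_single]
  simp

/-- The standard basis vectors of the model. -/
def stdVec (w : Fin n → ℕ) (k : Fin (mu w)) : Model w := Pi.single k 1

/-- The operator `x ∇_{∂_x}` on the model. -/
def modelOp (w : Fin n → ℕ) : Module.End RTau (Model w) :=
  LinearMap.pi fun i => (xDer : RTot →ₗ[RTau] RTot) ∘ₗ LinearMap.proj i +
    ∑ k, (LinearMap.mulLeft RTau (algebraMap RLog RTot (matX w i k))) ∘ₗ LinearMap.proj k

theorem modelOp_apply (w : Fin n → ℕ) (m : Model w) (i : Fin (mu w)) :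
    modelOp w m i = xDer (m i) + ∑ k, algebraMap RLog RTot (matX w i k) * m k := by
  simp [modelOp]

theorem modelOp_smul (w : Fin n → ℕ) (r : RTot) (m : Model w) :
    modelOp w (r • m) = xDer r • m + r • modelOp w m := by
  funext i
  simp only [modelOp_apply, Pi.add_apply, Pi.smul_apply, smul_eq_mul, Derivation.leibniz,
    mul_add, Finset.mul_sum, mul_left_comm r]
  ring

theorem modelOp_stdVec {w : Fin n → ℕ} (hw : ∀ i, 1 ≤ w i) (k : Fin (mu w)) :
    modelOp w (stdVec w k) =
      resEig w k • stdVec w k - (T 1 : RTau) • nextVec w (stdVec w) k := by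
  rw [← sum_matX_smul hw]
  funext i
  rw [modelOp_apply, Finset.sum_apply, Finset.sum_eq_single k, Finset.sum_eq_single i]
  · have : xDer (stdVec w k i) = 0 := by
      rw [stdVec, Pi.single_apply]
      split_ifs
      · exact Derivation.map_one_eq_zero _
      · exact map_zero _
    rw [this, Pi.smul_apply, stdVec, stdVec, Pi.single_eq_same, Pi.single_eq_same, Algebra.smul_def,
      zero_add]
  · intro j _ hj
    rw [Pi.smul_apply, stdVec, Pi.single_eq_of_ne hj.symm, smul_zero]
  · simp
  · intro j _ hj
    rw [stdVec, Pi.single_eq_of_ne hj, mul_zero]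
  · simp

/-- The polynomial `∏_i ∏_{j < c_i} (j - w_i Y)`. -/
def opPoly (w : Fin n → ℕ) (c : Fin (n + 1) → ℕ) : Polynomial RTau :=
  ∏ i, ∏ j ∈ Finset.range (c i), ((j : Polynomial RTau) - (wt w i : Polynomial RTau) * Polynomial.X)

theorem opPoly_add_single (w : Fin n → ℕ) (c : Fin (n + 1) → ℕ) (i : Fin (n + 1)) :
    opPoly w (c + Pi.single i 1) =
      ((c i : Polynomial RTau) - (wt w i : Polynomial RTau) * Polynomial.X) * opPoly w c := by
  rw [opPoly, opPoly, ← Finset.mul_prod_erase _ _ (Finset.mem_univ i),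
    ← Finset.mul_prod_erase (a := i) _ _ (Finset.mem_univ i), ← mul_assoc]
  congr 1
  · simp [Finset.prod_range_succ, mul_comm]
  · refine Finset.prod_congr rfl fun j hj => ?_
    simp [(Finset.mem_erase.1 hj).1]

/-- Raising `j` by `w_i` in the factor `j - w_i Y` amounts to replacing `Y` by `Y - 1`, the same
substitution for every `i`. -/
theorem opPoly_add_wt (w : Fin n → ℕ) (c : Fin (n + 1) → ℕ) :
    opPoly w (c + wt w) = (opPoly w c).comp (Polynomial.X - 1) * opPoly w (wt w) := by
  rw [mul_comm]
  simp only [opPoly, Polynomial.prod_comp, ← Finset.prod_mul_distrib]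
  refine Finset.prod_congr rfl fun i _ => ?_
  rw [Pi.add_apply, add_comm, Finset.prod_range_add]
  congr 1
  refine Finset.prod_congr rfl fun j _ => ?_
  simp
  ring

/-- The vector of the model that corresponds to the monomial `∏ v_i^{c_i}`. -/
def modelVec (w : Fin n → ℕ) (c : Fin (n + 1) → ℕ) : Model w :=
  (T (-(∑ i, c i : ℕ)) : RTau) •
    Polynomial.aeval (modelOp w) (opPoly w c) (stdVec w ⟨0, mu_pos w⟩)

theorem modelVec_zero (w : Fin n → ℕ) : modelVec w 0 = stdVec w ⟨0, mu_pos w⟩ := by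
  simp [modelVec, opPoly]

/-- The counterpart of `tau_smul_term_mul` in the model; the factors of `opPoly` are chosen to make
it hold. -/
theorem tau_smul_modelVec_add_single (w : Fin n → ℕ) (c : Fin (n + 1) → ℕ) (i : Fin (n + 1)) :
    (T 1 : RTau) • modelVec w (c + Pi.single i 1) =
      (c i : ℂ) • modelVec w c - (wt w i : ℂ) • modelOp w (modelVec w c) := by
  have hs : ∑ j, (c + Pi.single i 1 : Fin (n + 1) → ℕ) j = ∑ j, c j + 1 := by
    simp [Finset.sum_add_distrib, Pi.single_apply]
  rw [modelVec, hs, smul_smul, ← T_add, opPoly_add_single, map_mul, Module.End.mul_apply, modelVec,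
    map_smul]
  have : (1 + -((∑ j, c j + 1 : ℕ) : ℤ)) = -(∑ i, c i : ℕ) := by push_cast; ring
  rw [this, smul_comm (c i : ℂ), smul_comm (wt w i : ℂ), ← smul_sub]
  congr 1
  simp [Nat.cast_smul_eq_nsmul]

/-- The model repeats the chain of the `ω^φ_k`: each step applies `s_k / μ - x ∇_{∂_x}`, up to a
factor, to a basis vector. The case `k = μ` records that the chain closes up. -/
theorem modelVec_cnt {w : Fin n → ℕ} (hw : ∀ i, 1 ≤ w i) (k : ℕ) (hk : k ≤ mu w) :
    modelVec w (cnt w k) = wprod w k • (if h : k < mu w then stdVec w ⟨k, h⟩ else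
      ((∏ l, (w l : ℂ) ^ w l)⁻¹ : ℂ) • (Polynomial.X : RLog) • stdVec w ⟨0, mu_pos w⟩) := by
  induction k with
  | zero =>
    rw [cnt_zero, modelVec_zero, dif_pos (mu_pos w)]
    simp [wprod]
  | succ k ih =>
    have hk' : k < mu w := hk
    have h1 := cnt_succ w ⟨k, hk'⟩
    have h2 := wprod_succ w ⟨k, hk'⟩
    have h3 := tau_smul_modelVec_add_single w (cnt w k) (idx w ⟨k, hk'⟩)
    have h4 := resEig_mul_wt hw ⟨k, hk'⟩
    have h5 := modelOp_stdVec hw ⟨k, hk'⟩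
    simp only at h1 h2 h4
    have ih' := ih hk'.le
    rw [dif_pos hk'] at ih'
    rw [← theta_tau_smul (modelVec w (cnt w (k + 1))), h1, h3, ih', h2, ← h4]
    rw [← algebraMap_smul RTau (wprod w k) (stdVec w _), map_smul, h5, algebraMap_smul]
    -- The case distinction at `k + 1` is the one in the definition of `nextVec` at `k`.
    change _ = _ • nextVec w (stdVec w) ⟨k, hk'⟩
    generalize nextVec w (stdVec w) ⟨k, hk'⟩ = a
    generalize stdVec w ⟨k, hk'⟩ = b
    conv_rhs => rw [← theta_tau_smul a, smul_comm]
    generalize (T 1 : RTau) • a = a'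
    congr 1
    module

theorem modelVec_wt {w : Fin n → ℕ} (hw : ∀ i, 1 ≤ w i) :
    modelVec w (wt w) = (T 1 : RTot) • stdVec w ⟨0, mu_pos w⟩ := by
  have h := modelVec_cnt hw (mu w) le_rfl
  have h0 : ∏ l, (w l : ℂ) ^ w l ≠ 0 := by
    rw [← wprod_mu hw]
    exact wprod_ne_zero hw _
  rw [cnt_mu hw, dif_neg (lt_irrefl _), wprod_mu hw, smul_smul, mul_inv_cancel₀ h0, one_smul] at h
  rw [h, ← algebraMap_smul RTot (Polynomial.X : RLog)]
  simp

/-- With `E` for `modelOp w`, one has `(E - 1) x = x E`. By `opPoly_add_wt` the polynomial of `c` is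
evaluated at `E - 1` on a multiple of `x e₀`, and `x` can be pulled out, turning `E - 1` back into
`E`. -/
theorem modelVec_add_wt {w : Fin n → ℕ} (hw : ∀ i, 1 ≤ w i) (c : Fin (n + 1) → ℕ) :
    modelVec w (c + wt w) = (T 1 : RTot) • modelVec w c := by
  have h1 := modelVec_wt hw
  have h3 := aeval_comm_of_comm (LinearMap.lsmul RTot (Model w) (T 1) |>.restrictScalars RTau)
    (modelOp w - 1) (modelOp w) (fun v => by simp [modelOp_smul, xDer_T_one]) (opPoly w c)
    (stdVec w ⟨0, mu_pos w⟩)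
  simp only [LinearMap.coe_restrictScalars, LinearMap.lsmul_apply] at h3
  have hs : ∑ j, (c + wt w) j = ∑ j, c j + ∑ j, wt w j := by
    simp [Finset.sum_add_distrib]
  rw [modelVec, hs, opPoly_add_wt, map_mul, Module.End.mul_apply, modelVec,
    ← smul_comm (T _ : RTau),
    ← h3, ← h1, modelVec, map_smul, smul_smul, ← T_add, Polynomial.aeval_comp]
  congr 2
  · push_cast; ring
  · simp

theorem modelVec_add_nsmul_wt {w : Fin n → ℕ} (hw : ∀ i, 1 ≤ w i) (c : Fin (n + 1) → ℕ) (m : ℕ) :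
    modelVec w (c + m • wt w) = (T m : RTot) • modelVec w c := by
  induction m with
  | zero => simp
  | succ m ih =>
    rw [succ_nsmul, ← add_assoc, modelVec_add_wt hw, ih, smul_smul, ← T_add]
    push_cast
    rw [add_comm (1 : ℤ)]

/-- The linear map from functions to the model that sends `∏ v_i^{c_i}` to `modelVec w c`. -/
def toModel (w : Fin n → ℕ) : Coord n →ₗ[RTot] Model w :=
  Finsupp.linearCombination RTot
    (fun a : Fin n → ℤ => (T (-(shiftExp a : ℤ)) : RTot) • modelVec w (liftExp w a)) ∘ₗ
      (AddMonoidAlgebra.coeffLinearEquiv RTot).toLinearMap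

theorem toModel_single (w : Fin n → ℕ) (a : Fin n → ℤ) (r : RTot) :
    toModel w (AddMonoidAlgebra.single a r) =
      r • (T (-(shiftExp a : ℤ)) : RTot) • modelVec w (liftExp w a) := by
  simp [toModel]

/-- `toModel` is defined through one chosen lift of each Laurent monomial. Two lifts differ by a
multiple of `wt w`, which changes both the monomial and `modelVec` by the same power of `x`. -/
theorem toModel_vmon {w : Fin n → ℕ} (hw : ∀ i, 1 ≤ w i) (c : Fin (n + 1) → ℕ) :
    toModel w (vmon w c) = modelVec w c := by
  rw [vmon_eq, toModel_single, smul_smul, ← T_add]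
  set a : Fin n → ℤ := fun i => (c i.succ : ℤ) - c 0 * w i with ha
  have h : liftExp w a + c 0 • wt w = c + shiftExp a • wt w := by
    funext i
    refine Fin.cases ?_ (fun i => ?_) i
    · simp [liftExp, wt, add_comm]
    · have := Int.toNat_of_nonneg (shiftExp_spec hw a i)
      zify
      simp only [liftExp, wt, Pi.add_apply, Fin.cons_succ, Pi.smul_apply, smul_eq_mul,
        Nat.cast_add, Nat.cast_mul, this]
      simp only [ha]
      ring
  have h' := congrArg (modelVec w) h
  rw [modelVec_add_nsmul_wt hw, modelVec_add_nsmul_wt hw] at h'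
  rw [add_comm, T_add, mul_smul, h', smul_smul, ← T_add]
  simp

/-- On a monomial, the relation is the identity `tau_smul_modelVec_add_single` for `i` minus `w_i`
times the one for `0`; the terms with `modelOp` cancel. -/
theorem toModel_relOp {w : Fin n → ℕ} (hw : ∀ i, 1 ≤ w i) (i : Fin n) (g : Coord n) :
    toModel w (relOp w i g) = 0 := by
  have hC : ∀ (r : ℂ) (g : Coord n), toModel w (r • g) = r • toModel w g := fun r g => by
    rw [← algebraMap_smul RTot r g, map_smul, algebraMap_smul]
  have htau : ∀ (r : RTau) (g : Coord n), toModel w (r • g) = r • toModel w g := fun r g => by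
    rw [← algebraMap_smul RTot r g, map_smul, algebraMap_smul]
  have hg : g ∈ Submodule.span RTot (Set.range (vmon w)) := by rw [span_vmon hw]; trivial
  induction hg using Submodule.span_induction with
  | mem g hg =>
    obtain ⟨c, rfl⟩ := hg
    rw [relOp_vmon, map_sub, hC, htau, map_sub, hC, ← vmon_add_single, ← vmon_add_single,
      toModel_vmon hw, toModel_vmon hw, toModel_vmon hw, smul_sub, smul_comm (T 1 : RTau) (w i : ℂ),
      tau_smul_modelVec_add_single, tau_smul_modelVec_add_single]
    simp only [wt, Fin.cons_succ, Fin.cons_zero]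
    generalize modelOp w (modelVec w c) = a
    generalize modelVec w c = b
    module
  | zero => rw [map_zero, map_zero]
  | add a b _ _ ha hb => rw [map_add, map_add, ha, hb, add_zero]
  | smul r a _ ha => rw [map_smul, map_smul, ha, smul_zero]

theorem linearIndependent_omegaPhi {w : Fin n → ℕ} (hw : ∀ i, 1 ≤ w i) :
    LinearIndependent RTot (omegaPhi w) := by
  obtain ⟨φ, hφ⟩ := exists_lift w (toModel w) (toModel_relOp hw)
  refine LinearIndependent.of_comp φ ?_
  have : φ ∘ omegaPhi w = fun k => Pi.single k 1 := by
    funext k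
    rw [Function.comp_apply, omegaPhi_eq, omegaNat,
      ← algebraMap_smul RTot (wprod w k)⁻¹, map_smul, hφ, toModel_vmon hw,
      modelVec_cnt hw _ k.2.le, dif_pos k.2, algebraMap_smul, smul_smul,
      inv_mul_cancel₀ (wprod_ne_zero hw _), one_smul]
    rfl
  rw [this]
  exact Pi.linearIndependent_single_one (Fin (mu w)) RTot

/-! ### The lattice generated by the sections `ω^φ_k` -/

/-- Covers both operators at once: `ε = 1` and `δ = 0` for `x ∇_{∂_x}`, `ε = 0` and `δ = ∂/∂θ` for
`∇_{∂_θ}`. -/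
theorem stable_span {w : Fin n → ℕ} (f : GM w →ₗ[ℂ] GM w) (δ : RTau → RTau) (ε : RLog)
    (hC : ∀ (a : RTau) (m : GM w), f (a • m) = δ a • m + a • f m)
    (hX : ∀ m : GM w, f ((Polynomial.X : RLog) • m) = (Polynomial.X : RLog) • (ε • m + f m))
    (S : Set (GM w)) (hS : ∀ m ∈ S, f m ∈ Submodule.span RLog S) :
    ∀ m ∈ Submodule.span RLog S, f m ∈ Submodule.span RLog S := by
  set L := Submodule.span RLog S with hL
  have htau : ∀ (r : RTau) (m : GM w), m ∈ L → r • m ∈ L := fun r m hm => by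
    rw [← C_smul]
    exact L.smul_mem _ hm
  intro m hm
  induction hm using Submodule.span_induction with
  | mem m hm => exact hS m hm
  | zero => rw [map_zero]; exact zero_mem _
  | add a b _ _ ha hb => rw [map_add]; exact add_mem ha hb
  | smul p a ha' ha =>
    induction p using Polynomial.induction_on with
    | C r =>
      rw [C_smul, hC]
      exact add_mem (htau _ _ ha') (htau _ _ ha)
    | add p q hp hq => rw [add_smul, map_add]; exact add_mem hp hq
    | monomial k r ih =>
      rw [pow_succ', mul_left_comm, mul_smul, hX]
      exact L.smul_mem _ (add_mem (L.smul_mem _ (L.smul_mem _ ha')) ih)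

theorem nablaTheta_smul (w : Fin n → ℕ) (r : RTot) (m : GM w) :
    nablaTheta w (r • m) = dTheta₁ r • m + r • nablaTheta w m := by
  rw [nablaTheta, LinearMap.smul_apply, nablaTau_smul, smul_add, dTheta₁, Derivation.smul_apply,
    LinearMap.smul_apply, smul_comm r, smul_assoc, algebraMap_smul]

theorem dTheta₁_algebraMap (a : RTau) :
    dTheta₁ (algebraMap RTau RTot a) = algebraMap RTau RTot (dTheta₀ a) := by
  rw [dTheta₁, dTheta₀, Derivation.smul_apply, Derivation.smul_apply, dTau₁_algebraMap, smul_eq_mul,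
    smul_eq_mul, map_mul]

theorem nablaTheta_tau_smul (w : Fin n → ℕ) (a : RTau) (m : GM w) :
    nablaTheta w (a • m) = dTheta₀ a • m + a • nablaTheta w m := by
  rw [← algebraMap_smul RTot a m, nablaTheta_smul, dTheta₁_algebraMap, algebraMap_smul,
    algebraMap_smul]

theorem omegaPhi_mem (w : Fin n → ℕ) (k : Fin (mu w)) : omegaPhi w k ∈ LPhi w :=
  Submodule.subset_span ⟨k, rfl⟩

theorem xNablaX_mem_LPhi {w : Fin n → ℕ} (hw : ∀ i, 1 ≤ w i) :
    ∀ m ∈ LPhi w, xNablaX w m ∈ LPhi w := by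
  refine stable_span ((xNablaX w).restrictScalars ℂ) (fun _ => 0) 1
    (fun a m => by rw [zero_smul, zero_add]; exact map_smul (xNablaX w) a m)
    (fun m => by rw [one_smul]; exact xNablaX_X_smul w m) _ ?_
  rintro _ ⟨k, rfl⟩
  rw [LinearMap.restrictScalars_apply, xNablaX_omegaPhi hw]
  exact sum_mem fun i _ => Submodule.smul_mem _ _ (omegaPhi_mem w i)

theorem nablaTheta_mem_LPhi {w : Fin n → ℕ} (hw : ∀ i, 1 ≤ w i) :
    ∀ m ∈ LPhi w, nablaTheta w m ∈ LPhi w := by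
  refine stable_span (nablaTheta w) dTheta₀ 0 (nablaTheta_tau_smul w)
    (fun m => by rw [zero_smul, zero_add]; exact nablaTheta_X_smul w m) _ ?_
  rintro _ ⟨k, rfl⟩
  rw [nablaTheta_omegaPhi hw]
  exact sum_mem fun i _ => Submodule.smul_mem _ _ (omegaPhi_mem w i)

/-- The basis `ω^φ` of the lattice. -/
def basisPhi {w : Fin n → ℕ} (hw : ∀ i, 1 ≤ w i) : Module.Basis (Fin (mu w)) RLog (LPhi w) :=
  Module.Basis.span <| (linearIndependent_omegaPhi hw).restrict_scalars (R := RLog) <| by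
    intro a b h
    simp only [Algebra.smul_def, mul_one] at h
    exact Polynomial.toLaurent_injective h

theorem basisPhi_apply {w : Fin n → ℕ} (hw : ∀ i, 1 ≤ w i) (k : Fin (mu w)) :
    (basisPhi hw k : GM w) = omegaPhi w k := by
  exact congrArg Subtype.val (Module.Basis.span_apply _ k)

/-! ### Restriction to `x = 0` -/

section Restriction

variable {w : Fin n → ℕ} (L : Submodule RLog (GM w))

theorem X_smul_mem_xMul (m : L) : (Polynomial.X : RLog) • m ∈ xMul L := ⟨m, rfl⟩

/-- `x` acts as `0` on `L / x L`, so a polynomial in `x` acts through its constant term. -/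
theorem mk_smul_eq (p : RLog) (m : L) :
    (Submodule.Quotient.mk (p • m) : Lbar L) = p.coeff 0 • Submodule.Quotient.mk m := by
  rw [← C_smul, ← Submodule.Quotient.mk_smul, Submodule.Quotient.eq]
  have h : p • m = (Polynomial.X : RLog) • p.divX • m + Polynomial.C (p.coeff 0) • m := by
    conv_lhs => rw [← Polynomial.X_mul_divX_add p, add_smul, mul_smul]
  rw [h, add_sub_cancel_right]
  exact X_smul_mem_xMul L _

/-- A basis of `L` restricts to a basis of `L / x L`. -/
def restrictBasis {ι : Type} [Finite ι] (b : Module.Basis ι RLog L) :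
    Module.Basis ι RTau (Lbar L) :=
  Module.Basis.mk (v := fun i => Submodule.Quotient.mk (b i))
    (by
      cases nonempty_fintype ι
      rw [Fintype.linearIndependent_iff]
      intro g hg i
      have h1 : (Submodule.Quotient.mk (∑ i, Polynomial.C (g i) • b i) : Lbar L) = 0 := by
        rw [← hg, ← Submodule.mkQ_apply, map_sum]
        refine Finset.sum_congr rfl fun i _ => ?_
        rw [Submodule.mkQ_apply, mk_smul_eq, Polynomial.coeff_C_zero]
      -- The combination lies in `x L`, so its coordinates, which are the constants `g i`, are
      -- divisible by `x`.
      obtain ⟨y, hy⟩ := (Submodule.Quotient.mk_eq_zero _).1 h1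
      have h2 := congrArg (fun m => (b.repr m i).coeff 0) hy
      simp only [LinearMap.lsmul_apply, map_smul, Finsupp.smul_apply, smul_eq_mul,
        Polynomial.coeff_X_mul_zero, b.repr_sum_self, Polynomial.coeff_C_zero] at h2
      exact h2.symm)
    (by
      cases nonempty_fintype ι
      rintro m -
      obtain ⟨m, rfl⟩ := Submodule.Quotient.mk_surjective _ m
      rw [← b.sum_repr m, ← Submodule.mkQ_apply, map_sum]
      refine sum_mem fun i _ => ?_
      rw [Submodule.mkQ_apply, mk_smul_eq]
      exact Submodule.smul_mem _ _ (Submodule.subset_span ⟨i, rfl⟩))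

theorem restrictBasis_apply {ι : Type} [Finite ι] (b : Module.Basis ι RLog L) (i : ι) :
    restrictBasis L b i = Submodule.Quotient.mk (b i) := by simp [restrictBasis]

theorem residue_mk (h : ∀ m ∈ L, xNablaX w m ∈ L) (m : L) :
    residue L h (Submodule.Quotient.mk m) =
      Submodule.Quotient.mk (⟨xNablaX w m, h m m.2⟩ : L) := rfl

theorem thetaBar_mk (h : ∀ m ∈ L, nablaTheta w m ∈ L) (m : L) :
    thetaBar L h (Submodule.Quotient.mk m) =
      Submodule.Quotient.mk (⟨nablaTheta w m, h m m.2⟩ : L) := rfl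

theorem thetaBar_smul (h : ∀ m ∈ L, nablaTheta w m ∈ L) (a : RTau) (m : Lbar L) :
    thetaBar L h (a • m) = dTheta₀ a • m + a • thetaBar L h m := by
  obtain ⟨m, rfl⟩ := Submodule.Quotient.mk_surjective _ m
  rw [← Submodule.Quotient.mk_smul, thetaBar_mk, thetaBar_mk, ← Submodule.Quotient.mk_smul,
    ← Submodule.Quotient.mk_smul, ← Submodule.Quotient.mk_add]
  exact congrArg _ (Subtype.ext (nablaTheta_tau_smul w a m))

theorem mk_eq_sum {ι : Type} [Fintype ι] (b : Module.Basis ι RLog L) (A : ι → RLog) (m : L)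
    (hm : (m : GM w) = ∑ i, A i • (b i : GM w)) :
    (Submodule.Quotient.mk m : Lbar L) = ∑ i, (A i).eval 0 • restrictBasis L b i := by
  have : m = ∑ i, A i • b i := Subtype.ext (by simp [hm])
  rw [this, ← Submodule.mkQ_apply, map_sum]
  refine Finset.sum_congr rfl fun i _ => ?_
  rw [Submodule.mkQ_apply, mk_smul_eq, restrictBasis_apply, Polynomial.coeff_zero_eq_eval_zero]

end Restriction

/-! ### The residue on the lattice: matrix and eigenvalues -/

theorem eval_matX (w : Fin n → ℕ) (i k : Fin (mu w)) : (matX w i k).eval 0 = matXBar w i k := by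
  simp [matX, matXBar, A0PhiBar, Polynomial.algebraMap_apply]

theorem eval_matTheta (w : Fin n → ℕ) (i k : Fin (mu w)) :
    (matTheta w i k).eval 0 = matThetaBar w i k := by
  simp [matTheta, matThetaBar, A0PhiBar, Polynomial.algebraMap_apply]

theorem residue_basis {w : Fin n → ℕ} (hw : ∀ i, 1 ≤ w i) (h : ∀ m ∈ LPhi w, xNablaX w m ∈ LPhi w)
    (k : Fin (mu w)) :
    residue (LPhi w) h (restrictBasis _ (basisPhi hw) k) =
      ∑ i, matXBar w i k • restrictBasis _ (basisPhi hw) i := by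
  rw [restrictBasis_apply, residue_mk, mk_eq_sum _ (basisPhi hw) (fun i => matX w i k)]
  · simp only [eval_matX]
  · simp only [basisPhi_apply]
    exact xNablaX_omegaPhi hw k

theorem thetaBar_basis {w : Fin n → ℕ} (hw : ∀ i, 1 ≤ w i)
    (h : ∀ m ∈ LPhi w, nablaTheta w m ∈ LPhi w) (k : Fin (mu w)) :
    thetaBar (LPhi w) h (restrictBasis _ (basisPhi hw) k) =
      ∑ i, matThetaBar w i k • restrictBasis _ (basisPhi hw) i := by
  rw [restrictBasis_apply, thetaBar_mk, mk_eq_sum _ (basisPhi hw) (fun i => matTheta w i k)]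
  · simp only [eval_matTheta]
  · simp only [basisPhi_apply]
    exact nablaTheta_omegaPhi hw k

theorem toMatrix_residue {w : Fin n → ℕ} (hw : ∀ i, 1 ≤ w i)
    (h : ∀ m ∈ LPhi w, xNablaX w m ∈ LPhi w) :
    LinearMap.toMatrix (restrictBasis _ (basisPhi hw)) (restrictBasis _ (basisPhi hw))
      (residue (LPhi w) h) = matXBar w := by
  ext1 i k
  rw [LinearMap.toMatrix_apply, residue_basis, Module.Basis.repr_sum_self]

/-- The only entry above the diagonal is the corner one, a multiple of `x`. -/
theorem matXBar_apply_of_lt {w : Fin n → ℕ} {i k : Fin (mu w)} (h : i < k) :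
    matXBar w i k = 0 := by
  have h1 : (i : ℕ) ≠ k + 1 := by have := Fin.lt_def.1 h; omega
  have h2 : RPhi w i k = 0 := Matrix.diagonal_apply_ne _ h.ne
  rw [← eval_matX, matX, Matrix.add_apply, Matrix.neg_apply, Matrix.smul_apply,
    Matrix.map_apply, h2, A0Phi, if_neg h1]
  split_ifs <;> simp

theorem matXBar_apply_self {w : Fin n → ℕ} (hw : ∀ i, 1 ≤ w i) (k : Fin (mu w)) :
    matXBar w k k = C (resEig w k) := by
  rw [← eval_matX, matX, RPhi_eq hw]
  have h1 : (k : ℕ) ≠ k + 1 := by omega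
  have h2 : ((A0Phi w k k).eval 0) = 0 := by
    rw [A0Phi, if_neg h1]
    split_ifs <;> simp
  simp [Polynomial.algebraMap_apply, h2]

/-- An endomorphism that is killed by `∏ (Y - r_i)` has its eigenvalues among the `r_i`. -/
theorem eigenvaluesIn_of_aeval_eq_zero {M ι : Type} [AddCommGroup M] [Module RTau M] [Fintype ι]
    (ρ : Module.End RTau M) (I : Set ℝ) (r : ι → ℂ) (hr : ∀ i, ∃ t ∈ I, r i = (t : ℂ))
    (h : Polynomial.aeval ρ (∏ i, (Polynomial.X - Polynomial.C (C (r i) : RTau))) = 0) :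
    EigenvaluesIn ρ I := by
  intro θ₀ _ z hz
  by_contra hcon
  obtain ⟨v, hv⟩ := hz.exists_hasEigenvector
  have h1 := Module.End.aeval_apply_of_hasEigenvector
    (p := ∏ i, (Polynomial.X - Polynomial.C (C (r i) : RTau))) hv
  obtain ⟨m, hm⟩ := Submodule.Quotient.mk_surjective _ v
  have h2 : Polynomial.aeval (fibreEnd ρ θ₀)
      (∏ i, (Polynomial.X - Polynomial.C (C (r i) : RTau))) v = 0 := by
    rw [← hm, ← Submodule.mkQ_apply, aeval_comm_of_comm (thetaSub M θ₀).mkQ _ ρ (fun _ => rfl), h,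
      LinearMap.zero_apply, map_zero]
  rw [h2] at h1
  have h3 : (∏ i, (Polynomial.X - Polynomial.C (C (r i) : RTau))).eval (C z) =
      C (∏ i, (z - r i)) := by
    simp [Polynomial.eval_prod]
  have h4 : ∏ i, (z - r i) ≠ 0 := by
    refine Finset.prod_ne_zero_iff.2 fun i _ h0 => hcon ?_
    obtain ⟨t, ht, hrt⟩ := hr i
    exact ⟨t, ht, (sub_eq_zero.1 h0).trans hrt⟩
  rw [h3] at h1
  -- The scalars are not a field, but a non-zero constant is invertible, which forces the
  -- eigenvector to vanish.
  have h5 := congrArg ((C (∏ i, (z - r i))⁻¹ : RTau) • ·) h1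
  simp only [smul_zero, smul_smul, ← map_mul, inv_mul_cancel₀ h4, map_one, one_smul] at h5
  exact hv.2 h5.symm

theorem resEig_mem (w : Fin n → ℕ) (k : Fin (mu w)) :
    ∃ t ∈ Set.Ico (0 : ℝ) 1, resEig w k = (t : ℂ) := by
  have hm : (0 : ℚ) < mu w := by exact_mod_cast mu_pos w
  refine ⟨((s w k / mu w : ℚ) : ℝ), ⟨?_, ?_⟩, ?_⟩
  · exact_mod_cast div_nonneg (s_nonneg w k) hm.le
  · exact_mod_cast (div_lt_one hm).2 (s_lt_mu w k)
  · rw [resEig]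
    norm_cast

/-- The matrix at `x = 0` is lower triangular with diagonal entries `s_k / μ`, so by Cayley-Hamilton
the residue is killed by `∏ (Y - s_k / μ)`, and the identity passes to all fibres. -/
theorem eigenvaluesIn_residue {w : Fin n → ℕ} (hw : ∀ i, 1 ≤ w i)
    (h : ∀ m ∈ LPhi w, xNablaX w m ∈ LPhi w) :
    EigenvaluesIn (residue (LPhi w) h) (Set.Ico 0 1) := by
  set b := restrictBasis _ (basisPhi hw) with hb
  have : Module.Free RTau (Lbar (LPhi w)) := Module.Free.of_basis b
  have : Module.Finite RTau (Lbar (LPhi w)) := Module.Finite.of_basis b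
  refine eigenvaluesIn_of_aeval_eq_zero _ _ (resEig w) (resEig_mem w) ?_
  have h1 := LinearMap.aeval_self_charpoly (residue (LPhi w) h)
  rw [← LinearMap.charpoly_toMatrix _ b, toMatrix_residue hw h, ← Matrix.charpoly_transpose,
    Matrix.charpoly_of_isUpperTriangular] at h1
  · simpa only [Matrix.transpose_apply, matXBar_apply_self hw] using h1
  · intro i j hij
    exact matXBar_apply_of_lt hij

theorem isDeligneExtension_LPhi {w : Fin n → ℕ} (hw : ∀ i, 1 ≤ w i) :
    IsDeligneExtension (LPhi w) := by
  refine ⟨Module.Finite.of_basis (basisPhi hw), Module.Projective.of_basis (basisPhi hw), ?_,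
    nablaTheta_mem_LPhi hw, xNablaX_mem_LPhi hw, eigenvaluesIn_residue hw _⟩
  rw [eq_top_iff, ← span_omegaPhi hw]
  exact Submodule.span_mono (Set.range_subset_iff.2 (omegaPhi_mem w))

/-! ### Flatness -/

theorem dTau_dX (g : Coord n) : dTau n (dX n g) = dX n (dTau n g) := by
  have h : ∀ r : RTot, dTau₁ (dX₁ r) = dX₁ (dTau₁ r) := fun r => by
    induction r using AddMonoidAlgebra.induction_linear with
    | zero => simp
    | add f g hf hg => simp only [map_add, hf, hg]
    | single m r =>
      simp only [dTau₁, coeffDer, dX₁, monomialDer_single, laurentDer_single,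
        AddMonoidHom.zero_apply, zero_mul, add_zero, ← zsmul_eq_mul, map_zsmul]
  induction g using AddMonoidAlgebra.induction_linear with
  | zero => simp
  | add f g hf hg => simp only [map_add, hf, hg]
  | single m r => simp only [dTau_single, dX_single, h]

/-- `∂_τ` and `∂_x` commute, so two extra terms matter: `∂_x (F g)` and `∂_τ (τ (∂F/∂x) g)` each
contribute `(∂F/∂x) g`, with the same sign on both sides. -/
theorem flat_on_functions (w : Fin n → ℕ) (g : Coord n) :
    dX n (dTau n g - F w * g) - (T 1 : RTau) • (dX n (F w) * (dTau n g - F w * g)) =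
      dTau n (dX n g - (T 1 : RTau) • (dX n (F w) * g)) -
        F w * (dX n g - (T 1 : RTau) • (dX n (F w) * g)) := by
  have h1 : dX n (F w * g) = F w * dX n g + dX n (F w) * g := by
    rw [Derivation.leibniz, smul_eq_mul, smul_eq_mul, mul_comm g]
  have h2 : dTau n (dX n (F w) * g) = dX n (F w) * dTau n g := by
    rw [Derivation.leibniz, dTau_dX, dTau_F, map_zero, smul_zero, add_zero, smul_eq_mul]
  rw [map_sub, map_sub, h1, dTau_tau_smul, h2, dTau_dX, mul_sub, mul_sub, smul_sub, mul_smul_comm,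
    mul_left_comm (F w) (dX n (F w)) g]
  have h3 : ∀ {A : Type} [AddCommGroup A] (a b c d e : A),
      e - (c + d) - (b - a) = e - (d + b) - (c - a) := by
    intros
    abel
  exact h3 _ _ _ _ _

theorem nablaX_nablaTau (w : Fin n → ℕ) (m : GM w) :
    nablaX w (nablaTau w m) = nablaTau w (nablaX w m) := by
  obtain ⟨g, rfl⟩ := classLin_surjective w m
  exact congrArg (classOf w) (flat_on_functions w g)

theorem nablaX_nablaTheta (w : Fin n → ℕ) (m : GM w) :
    nablaX w (nablaTheta w m) = nablaTheta w (nablaX w m) := by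
  rw [nablaTheta, LinearMap.smul_apply, LinearMap.smul_apply, map_smul, nablaX_nablaTau]

/-! ### Fibres over `θ₀ ≠ 0` -/

/-- If the scalars of `S` act through scalars of `R`, then finiteness over `S` implies finiteness
over `R`. -/
theorem finite_of_smul_eq {R S V : Type} [CommRing R] [CommRing S] [AddCommGroup V] [Module R V]
    [Module S V] (h : ∀ s : S, ∃ r : R, ∀ v : V, s • v = r • v) [hfin : Module.Finite S V] :
    Module.Finite R V := by
  obtain ⟨t, ht⟩ := hfin.fg_top
  refine ⟨t, ?_⟩
  rw [eq_top_iff]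
  rintro v -
  have hv : v ∈ Submodule.span S (t : Set V) := by rw [ht]; trivial
  induction hv using Submodule.span_induction with
  | mem v hv => exact Submodule.subset_span hv
  | zero => exact zero_mem _
  | add a b _ _ ha hb => exact add_mem ha hb
  | smul s a _ ha =>
    obtain ⟨r, hr⟩ := h s
    rw [hr]
    exact Submodule.smul_mem _ _ ha

section Fibres

variable {M Q : Type} [AddCommGroup M] [Module RTau M] [Module ℂ M] [IsScalarTower ℂ RTau M]
  [AddCommGroup Q] [Module RTau Q] [Module ℂ Q] [IsScalarTower ℂ RTau Q]

/-- On the fibre `θ` acts as `θ₀` and `τ` as `θ₀⁻¹`. Thus fibres of finite modules are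
finite-dimensional complex vector spaces. -/
theorem fibre_smul {θ₀ : ℂ} (hθ : θ₀ ≠ 0) (r : RTau) :
    ∃ c : ℂ, ∀ v : M ⧸ thetaSub M θ₀, r • v = c • v := by
  have h1 : ∀ v : M ⧸ thetaSub M θ₀, (T (-1) : RTau) • v = θ₀ • v := fun v => by
    obtain ⟨m, rfl⟩ := Submodule.Quotient.mk_surjective _ v
    rw [← Submodule.Quotient.mk_smul, ← Submodule.Quotient.mk_smul, Submodule.Quotient.eq]
    refine ⟨m, ?_⟩
    rw [LinearMap.lsmul_apply, sub_smul, ← algebraMap_smul RTau θ₀ m]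
    rfl
  have h2 : ∀ v : M ⧸ thetaSub M θ₀, (T 1 : RTau) • v = θ₀⁻¹ • v := fun v => by
    rw [← smul_right_injective _ hθ |>.eq_iff]
    simp only [smul_smul, mul_inv_cancel₀ hθ, one_smul]
    rw [← h1, theta_tau_smul]
  induction r using LaurentPolynomial.induction_on with
  | h_C a => exact ⟨a, fun v => algebraMap_smul RTau a v⟩
  | h_add hp hq =>
    obtain ⟨c, hc⟩ := hp
    obtain ⟨d, hd⟩ := hq
    exact ⟨c + d, fun v => by rw [add_smul, add_smul, hc, hd]⟩
  | h_C_mul_T k a ih =>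
    obtain ⟨c, hc⟩ := ih
    refine ⟨θ₀⁻¹ * c, fun v => ?_⟩
    rw [T_add, ← mul_assoc, mul_comm, mul_smul, hc, h2, mul_smul]
  | h_C_mul_T_Z k a ih =>
    obtain ⟨c, hc⟩ := ih
    refine ⟨θ₀ * c, fun v => ?_⟩
    rw [sub_eq_add_neg, T_add, ← mul_assoc, mul_comm, mul_smul, hc, h1, mul_smul]

/-- If `f ρ = (σ - N) f` with `N ≥ 1`, and if `ρ` and `σ` have their eigenvalues in `[0, 1)`,
then `f` vanishes on all fibres. -/
theorem map_mem_thetaSub [Module.Finite RTau M] [Module.Finite RTau Q] (ρ : Module.End RTau M)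
    (σ : Module.End RTau Q) (hρ : EigenvaluesIn ρ (Set.Ico 0 1))
    (hσ : EigenvaluesIn σ (Set.Ico 0 1)) (f : M →ₗ[RTau] Q) (N : ℕ)
    (hf : ∀ m, σ (f m) = f (((N + 1 : ℕ) : ℂ) • m + ρ m)) {θ₀ : ℂ} (hθ : θ₀ ≠ 0) (m : M) :
    f m ∈ thetaSub Q θ₀ := by
  have : Module.Finite ℂ (M ⧸ thetaSub M θ₀) := finite_of_smul_eq (fibre_smul hθ)
  have : Module.Finite ℂ (Q ⧸ thetaSub Q θ₀) := finite_of_smul_eq (fibre_smul hθ)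
  let A : Module.End ℂ (M ⧸ thetaSub M θ₀) := (fibreEnd ρ θ₀).restrictScalars ℂ
  -- Subtracting the shift `N + 1` makes `g` intertwine `A` and `B`.
  let B : Module.End ℂ (Q ⧸ thetaSub Q θ₀) :=
    (fibreEnd σ θ₀).restrictScalars ℂ - algebraMap ℂ _ ((N + 1 : ℕ) : ℂ)
  let g : (M ⧸ thetaSub M θ₀) →ₗ[ℂ] (Q ⧸ thetaSub Q θ₀) :=
    ((thetaSub M θ₀).mapQ (thetaSub Q θ₀) f (by
      rintro _ ⟨m, rfl⟩
      exact ⟨f m, by simp⟩)).restrictScalars ℂ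
  have hg : ∀ v, B (g v) = g (A v) := fun v => by
    obtain ⟨m, rfl⟩ := Submodule.Quotient.mk_surjective _ v
    change (Submodule.Quotient.mk (σ (f m)) - ((N + 1 : ℕ) : ℂ) • Submodule.Quotient.mk (f m) :
      Q ⧸ thetaSub Q θ₀) = Submodule.Quotient.mk (f (ρ m))
    rw [hf, map_add, Submodule.Quotient.mk_add, ← algebraMap_smul RTau _ m, map_smul,
      algebraMap_smul, Submodule.Quotient.mk_smul, add_sub_cancel_left]
  have hA : ∀ z, (minpoly ℂ A).IsRoot z → ∃ t ∈ Set.Ico (0 : ℝ) 1, z = (t : ℂ) := fun z hz => by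
    obtain ⟨v, hv⟩ := (Module.End.hasEigenvalue_of_isRoot hz).exists_hasEigenvector
    refine hρ θ₀ hθ z (Module.End.hasEigenvalue_of_hasEigenvector (x := v)
      ⟨Module.End.mem_eigenspace_iff.2 ?_, hv.2⟩)
    exact hv.apply_eq_smul.trans (algebraMap_smul RTau z v).symm
  have hB : ∀ z, (minpoly ℂ B).IsRoot z →
      ∃ t ∈ Set.Ico (0 : ℝ) 1, z + ((N + 1 : ℕ) : ℂ) = (t : ℂ) := fun z hz => by
    obtain ⟨v, hv⟩ := (Module.End.hasEigenvalue_of_isRoot hz).exists_hasEigenvector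
    refine hσ θ₀ hθ _ (Module.End.hasEigenvalue_of_hasEigenvector (x := v)
      ⟨Module.End.mem_eigenspace_iff.2 ?_, hv.2⟩)
    have h1 : fibreEnd σ θ₀ v - ((N + 1 : ℕ) : ℂ) • v = z • v := hv.apply_eq_smul
    rw [sub_eq_iff_eq_add, ← add_smul] at h1
    exact h1.trans (algebraMap_smul RTau _ v).symm
  -- A common root `z` would have both `z` and `z + N + 1` in `[0, 1)`.
  have hcop : IsCoprime (minpoly ℂ A) (minpoly ℂ B) := by
    rw [Polynomial.isCoprime_iff_aeval_ne_zero_of_isAlgClosed ℂ ℂ]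
    intro z
    by_contra! hz
    simp only [Polynomial.coe_aeval_eq_eval] at hz
    obtain ⟨t, ht, rfl⟩ := hA z hz.1
    obtain ⟨t', ht', h⟩ := hB _ hz.2
    have h' : t + ((N + 1 : ℕ) : ℝ) = t' := by exact_mod_cast h
    have h0 : (0 : ℝ) ≤ N := Nat.cast_nonneg N
    push_cast at h'
    linarith [ht.1, ht'.2]
  obtain ⟨a, b, hab⟩ := hcop
  -- The Bézout identity is evaluated at `B` on the image of `g`: `minpoly ℂ B` dies there, and
  -- `minpoly ℂ A` dies after being moved through `g`. So the image is `0`.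
  have h1 := congrArg (fun p => Polynomial.aeval B p (g (Submodule.Quotient.mk m))) hab
  simp only [map_add, map_mul, LinearMap.add_apply, Module.End.mul_apply, minpoly.aeval,
    LinearMap.zero_apply, map_zero, add_zero, map_one, Module.End.one_apply,
    aeval_comm_of_comm g B A hg] at h1
  exact (Submodule.Quotient.mk_eq_zero _).1 h1.symm

end Fibres

/-- A non-zero Laurent polynomial has only finitely many zeros in `ℂ^*`. -/
theorem eq_zero_of_forall_dvd (r : RTau) (h : ∀ θ₀ : ℂ, θ₀ ≠ 0 → ∃ q, r = (T (-1) - C θ₀) * q) :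
    r = 0 := by
  obtain ⟨k, p, hp⟩ := exists_T_pow r
  have hroot : ∀ t : ℂ, t ≠ 0 → p.IsRoot t := fun t ht => by
    -- `p` is a polynomial in `τ`, so the point `τ = t` is `θ = t⁻¹`.
    obtain ⟨q, hq⟩ := h t⁻¹ (inv_ne_zero ht)
    have h1 := congrArg (eval₂ (RingHom.id ℂ) (Units.mk0 t ht)) hp
    rw [eval₂_toLaurent, hq, map_mul, map_mul, map_sub, eval₂_T, eval₂_C] at h1
    simpa [Polynomial.eval₂_id] using h1
  have hp0 : p = 0 := by
    refine Polynomial.eq_zero_of_infinite_isRoot p (Set.Infinite.mono (s := {0}ᶜ) ?_ ?_)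
    · exact fun t ht => hroot t ht
    · exact (Set.finite_singleton (0 : ℂ)).infinite_compl
  rw [hp0, map_zero] at hp
  have h2 := congrArg (· * (T (-k) : RTau)) hp
  simp only [zero_mul, mul_assoc, ← T_add, add_neg_cancel, T_zero, mul_one] at h2
  exact h2.symm

/-! ### Uniqueness of the canonical extension -/

section Uniqueness

variable {w : Fin n → ℕ}

/-- Projectivity gives a section `s` of `L` into a free module. The coordinates of `s l` at `x = 0`
vanish for all `θ₀ ≠ 0`, hence vanish identically; so `s l` is divisible by `x`, and mapping back to
`L` shows that `l` is too. -/
theorem eq_zero_of_forall_mem_thetaSub (L : Submodule RLog (GM w)) [Module.Projective RLog L]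
    (q : Lbar L) (hq : ∀ θ₀ : ℂ, θ₀ ≠ 0 → q ∈ thetaSub (Lbar L) θ₀) : q = 0 := by
  obtain ⟨l, rfl⟩ := Submodule.Quotient.mk_surjective _ q
  obtain ⟨s, hs⟩ := Module.projective_def'.1 (inferInstance : Module.Projective RLog L)
  have hcoeff : ∀ j, (s l j).coeff 0 = 0 := fun j => by
    refine eq_zero_of_forall_dvd _ fun θ₀ hθ => ?_
    obtain ⟨q', hq'⟩ := hq θ₀ hθ
    obtain ⟨l', rfl⟩ := Submodule.Quotient.mk_surjective _ q'
    rw [LinearMap.lsmul_apply, ← Submodule.Quotient.mk_smul, eq_comm, Submodule.Quotient.eq] at hq'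
    obtain ⟨l'', hl⟩ := hq'
    rw [LinearMap.lsmul_apply, eq_sub_iff_add_eq', ← C_smul] at hl
    refine ⟨(s l' j).coeff 0, ?_⟩
    rw [← hl, map_add, map_smul, map_smul, Finsupp.add_apply, Finsupp.smul_apply,
      Finsupp.smul_apply, smul_eq_mul, smul_eq_mul, Polynomial.coeff_add,
      Polynomial.coeff_X_mul_zero, Polynomial.coeff_C_mul, add_zero]
  have h1 : s l = (Polynomial.X : RLog) • (s l).mapRange Polynomial.divX Polynomial.divX_zero := by
    ext1 j
    rw [Finsupp.smul_apply, Finsupp.mapRange_apply, smul_eq_mul]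
    conv_lhs => rw [← Polynomial.X_mul_divX_add (s l j), hcoeff, map_zero, add_zero]
  have h2 := congrArg (· l) hs
  simp only [LinearMap.comp_apply, LinearMap.id_apply] at h2
  rw [h1, map_smul] at h2
  rw [Submodule.Quotient.mk_eq_zero, ← h2]
  exact X_smul_mem_xMul L _

theorem finite_Lbar (L : Submodule RLog (GM w)) [Module.Finite RLog L] :
    Module.Finite RTau (Lbar L) := by
  refine finite_of_smul_eq (S := RLog) fun p => ⟨p.coeff 0, fun v => ?_⟩
  obtain ⟨m, rfl⟩ := Submodule.Quotient.mk_surjective _ v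
  exact mk_smul_eq L p m

theorem X_smul_injective (w : Fin n → ℕ) :
    Function.Injective fun m : GM w => (Polynomial.X : RLog) • m := by
  intro a b h
  have h1 := congrArg ((T (-1) : RTot) • ·) h
  simpa only [X_smul, smul_smul, ← T_add, neg_add_cancel, T_zero, one_smul] using h1

/-- Multiplication by `x ^ k` shifts the residue by `k`, which is why the interval of eigenvalues
pins down the lattice. -/
theorem xNablaX_X_pow_smul (w : Fin n → ℕ) (k : ℕ) (m : GM w) :
    xNablaX w ((Polynomial.X ^ k : RLog) • m) =
      (Polynomial.X ^ k : RLog) • ((k : ℂ) • m + xNablaX w m) := by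
  induction k with
  | zero => simp
  | succ k ih =>
    rw [pow_succ', mul_smul, xNablaX_X_smul, ih, mul_smul, ← smul_add]
    congr 2
    push_cast
    rw [add_smul, one_smul]
    abel

theorem exists_pow_smul_mem {L : Submodule RLog (GM w)}
    (hL : Submodule.span RTot (L : Set (GM w)) = ⊤) (m : GM w) :
    ∃ N : ℕ, (Polynomial.X ^ N : RLog) • m ∈ L := by
  have hm : m ∈ Submodule.span RTot (L : Set (GM w)) := by rw [hL]; trivial
  induction hm using Submodule.span_induction with
  | mem m hm => exact ⟨0, L.smul_mem _ hm⟩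
  | zero => exact ⟨0, by simp⟩
  | add a b _ _ ha hb =>
    obtain ⟨N, hN⟩ := ha
    obtain ⟨N', hN'⟩ := hb
    refine ⟨N + N', ?_⟩
    rw [smul_add]
    refine add_mem ?_ ?_
    · rw [add_comm, pow_add, mul_smul]
      exact L.smul_mem _ hN
    · rw [pow_add, mul_smul]
      exact L.smul_mem _ hN'
  | smul r a _ ha =>
    obtain ⟨N, hN⟩ := ha
    obtain ⟨k, p, hp⟩ := exists_T_pow r
    refine ⟨N + k, ?_⟩
    have h1 : (Polynomial.X ^ (N + k) : RLog) • r • a = p • (Polynomial.X ^ N : RLog) • a := by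
      rw [← algebraMap_smul RTot (Polynomial.X ^ (N + k) : RLog), ← algebraMap_smul RTot p,
        ← algebraMap_smul RTot (Polynomial.X ^ N : RLog), smul_smul, smul_smul]
      congr 1
      simp only [LaurentPolynomial.algebraMap_eq_toLaurent, hp, Polynomial.toLaurent_X_pow,
        Nat.cast_add, T_add]
      ring
    rw [h1]
    exact L.smul_mem _ hN

theorem exists_pow_smul_le {L : Submodule RLog (GM w)}
    (hL : Submodule.span RTot (L : Set (GM w)) = ⊤) {K : Submodule RLog (GM w)} (hK : K.FG) :
    ∃ N : ℕ, ∀ m ∈ K, (Polynomial.X ^ N : RLog) • m ∈ L := by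
  induction K, hK using Submodule.fg_induction with
  | singleton x =>
    obtain ⟨N, hN⟩ := exists_pow_smul_mem hL x
    refine ⟨N, fun m hm => ?_⟩
    obtain ⟨r, rfl⟩ := Submodule.mem_span_singleton.1 hm
    rw [smul_comm]
    exact L.smul_mem _ hN
  | sup K₁ K₂ _ _ h₁ h₂ =>
    obtain ⟨N, hN⟩ := h₁
    obtain ⟨N', hN'⟩ := h₂
    refine ⟨N + N', fun m hm => ?_⟩
    obtain ⟨a, ha, b, hb, rfl⟩ := Submodule.mem_sup.1 hm
    rw [smul_add]
    refine add_mem ?_ ?_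
    · rw [add_comm, pow_add, mul_smul]
      exact L.smul_mem _ (hN a ha)
    · rw [pow_add, mul_smul]
      exact L.smul_mem _ (hN' b hb)

/-- The map `L / x L → L' / x L'` induced by multiplication by `x ^ k`, if it maps `L` to `L'`. -/
def powMap (L L' : Submodule RLog (GM w)) (k : ℕ)
    (h : ∀ m ∈ L, (Polynomial.X ^ k : RLog) • m ∈ L') : Lbar L →ₗ[RTau] Lbar L' :=
  ((xMul L).mapQ (xMul L') ((LinearMap.lsmul RLog (GM w) (Polynomial.X ^ k)).restrict h) (by
    rintro _ ⟨m, rfl⟩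
    refine ⟨(LinearMap.lsmul RLog (GM w) (Polynomial.X ^ k)).restrict h m, ?_⟩
    rw [LinearMap.lsmul_apply, LinearMap.lsmul_apply, map_smul])).restrictScalars RTau

/-- Multiplication by `x ^ (k + 1)` intertwines the residue of `L`, shifted by `k + 1`, with that of
`L'`. It therefore vanishes modulo `x` on all fibres, so `x ^ (k + 1) L ⊆ x L'`, and `x` cancels
because it acts injectively on `G`. -/
theorem pow_smul_mem_of_succ {L L' : Submodule RLog (GM w)} (hL : IsDeligneExtension L)
    (hL' : IsDeligneExtension L') (k : ℕ)
    (h : ∀ m ∈ L, (Polynomial.X ^ (k + 1) : RLog) • m ∈ L') :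
    ∀ m ∈ L, (Polynomial.X ^ k : RLog) • m ∈ L' := by
  obtain ⟨hfin, -, -, -, hst, hev⟩ := hL
  obtain ⟨hfin', hproj', -, -, hst', hev'⟩ := hL'
  have := finite_Lbar L
  have := finite_Lbar L'
  intro m hm
  have hzero : powMap L L' (k + 1) h (Submodule.Quotient.mk ⟨m, hm⟩) = 0 := by
    refine eq_zero_of_forall_mem_thetaSub L' _ fun θ₀ hθ => ?_
    refine map_mem_thetaSub (residue L hst) (residue L' hst') hev hev' _ k (fun v => ?_) hθ _
    obtain ⟨l, rfl⟩ := Submodule.Quotient.mk_surjective _ v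
    refine congrArg Submodule.Quotient.mk (Subtype.ext ?_)
    exact xNablaX_X_pow_smul w (k + 1) l
  obtain ⟨l, hl⟩ := (Submodule.Quotient.mk_eq_zero (xMul L')).1 hzero
  have h1 : (Polynomial.X : RLog) • (l : GM w) = (Polynomial.X ^ (k + 1) : RLog) • m :=
    congrArg Subtype.val hl
  rw [pow_succ', mul_smul] at h1
  rw [← X_smul_injective w h1]
  exact l.2

theorem le_of_isDeligneExtension {L L' : Submodule RLog (GM w)} (hL : IsDeligneExtension L)
    (hL' : IsDeligneExtension L') : L ≤ L' := by
  -- `L` is finitely generated and `L'` generates `G` once `x` is inverted, so a power of `x` clears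
  -- all denominators; the power is then lowered to `0`.
  obtain ⟨N, hN⟩ := exists_pow_smul_le hL'.2.2.1 (Module.Finite.iff_fg.1 hL.1)
  induction N with
  | zero =>
    intro m hm
    simpa using hN m hm
  | succ k ih => exact ih (pow_smul_mem_of_succ hL hL' k hN)

end Uniqueness

end GaussManin

end

open GaussManin Matrix in
theorem theorem5p1 (n : ℕ) (hn : 1 ≤ n) (w : Fin n → ℕ) (hw : ∀ i, 1 ≤ w i) :
    -- `∇` is a flat connection on the Gauss-Manin system
    ((∀ (r : RTot) (m : GM w), nablaX w (r • m) = dX₁ r • m + r • nablaX w m) ∧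
      (∀ (r : RTot) (m : GM w), nablaTheta w (r • m) = dTheta₁ r • m + r • nablaTheta w m) ∧
      (∀ m : GM w, nablaX w (nablaTheta w m) = nablaTheta w (nablaX w m))) ∧
    -- `∇` has a logarithmic pole along `x = 0` on the lattice
    ∃ (hX : ∀ m ∈ LPhi w, xNablaX w m ∈ LPhi w)
      (hTheta : ∀ m ∈ LPhi w, nablaTheta w m ∈ LPhi w)
      (b : Module.Basis (Fin (mu w)) RLog (LPhi w))
      (b' : Module.Basis (Fin (mu w)) RTau (Lbar (LPhi w))),
      (∀ k, (b k : GM w) = omegaPhi w k) ∧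
      (∀ k, b' k = Submodule.Quotient.mk (b k)) ∧
      -- the matrices of `x ∇_{∂_x}` and of `∇_{∂_θ}`
      (∀ k, xNablaX w (omegaPhi w k) = ∑ i, matX w i k • omegaPhi w i) ∧
      (∀ k, nablaTheta w (omegaPhi w k) = ∑ i, matTheta w i k • omegaPhi w i) ∧
      -- the residue, its matrix and its eigenvalues
      LinearMap.toMatrix b' b' (residue (LPhi w) hX) = matXBar w ∧
      EigenvaluesIn (residue (LPhi w) hX) (Set.Ico 0 1) ∧
      -- the connection induced by `∇_{∂_θ}` on the restriction to `x = 0`, and its matrix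
      (∀ (a : RTau) (m : Lbar (LPhi w)), thetaBar (LPhi w) hTheta (a • m) =
        dTheta₀ a • m + a • thetaBar (LPhi w) hTheta m) ∧
      (∀ k, thetaBar (LPhi w) hTheta (b' k) = ∑ i, matThetaBar w i k • b' i) ∧
      -- the lattice is the canonical extension
      IsDeligneExtension (LPhi w) ∧
      ∀ L : Submodule RLog (GM w), IsDeligneExtension L → L = LPhi w := by
  refine ⟨⟨nablaX_smul w, nablaTheta_smul w, nablaX_nablaTheta w⟩, xNablaX_mem_LPhi hw,
    nablaTheta_mem_LPhi hw, basisPhi hw, restrictBasis _ (basisPhi hw), basisPhi_apply hw,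
    restrictBasis_apply _ _, xNablaX_omegaPhi hw, nablaTheta_omegaPhi hw, toMatrix_residue hw _,
    eigenvaluesIn_residue hw _, thetaBar_smul _ _, thetaBar_basis hw _,
    isDeligneExtension_LPhi hw, fun L hL => ?_⟩
  exact le_antisymm (le_of_isDeligneExtension hL (isDeligneExtension_LPhi hw))
    (le_of_isDeligneExtension (isDeligneExtension_LPhi hw) hL)
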